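/- Let $n\ge 1$ and let $$B(z)=\gamma\prod_{j=1}^{n}\frac{z-a_j}{1-\overline{a_j}z},\qquad |\gamma|=1,\quad a_1,\dots,a_n\in\mathbb{D},$$ be a Blaschke product of degree $n$ with exactly one critical value; that is, the set $\{w\in\mathbb{D}:\ w=B(z)\text{ and }B'(z)=0\text{ for some }z\in\mathbb{D}\}$ consists of exactly one point. Then $B$ has an elliptical Blaschke curve. Here a Blaschke curve of $B$ is a closed convex curve $\mathcal{C}$ contained in the open unit disk $\mathbb{D}$ (in degenerate cases, a single point) such that for every $\lambda$ on the unit circle $\mathbb{T}$ the convex polygon whose vertices are the solutions $z\in\mathbb{T}$ of $B(z)=\lambda$ is circumscribed about $\mathcal{C}$ (it contains $\mathcal{C}$, and each of its sides is tangent to $\mathcal{C}$ at exactly one point), and such that every point of $\mathcal{C}$ is the point of tangency of a side of such a polygon. "Elliptical" means that $\mathcal{C}$ is a nondegenerate ellipse (possibly a circle) if $n\ge 3$, and a single point (a degenerate ellipse) if $n=2$, where the polygons are chords of $\mathbb{T}$. (For $n=1$ there is no critical value.) -/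

import Mathlib

open scoped ComplexConjugate

/-- The finite Blaschke product `γ ∏ⱼ (z - aⱼ) / (1 - conj aⱼ z)`. It has degree `n`, and is a genuine
Blaschke product when `‖γ‖ = 1` and `‖a j‖ < 1` for all `j`. -/
noncomputable def blaschkeProduct {n : ℕ} (γ : ℂ) (a : Fin n → ℂ) (z : ℂ) : ℂ :=
  γ * ∏ j, (z - a j) / (1 - conj (a j) * z)

/-- The critical values of `B` in the open unit disk: the values of `B` at the points of the disk
where the derivative of `B` vanishes. -/
def criticalValues (B : ℂ → ℂ) : Set ℂ :=
  {w | w ∈ Metric.ball (0 : ℂ) 1 ∧ ∃ z ∈ Metric.ball (0 : ℂ) 1, deriv B z = 0 ∧ B z = w}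

/-- The points of the unit circle that `B` maps to `l`. -/
def circleFiber (B : ℂ → ℂ) (l : ℂ) : Set ℂ :=
  {z | ‖z‖ = 1 ∧ B z = l}

/-- For a set `V` of points of the unit circle: `[z, w]` is a side, run through counterclockwise, of
the convex polygon with vertex set `V`. That is, `z` and `w` are distinct vertices and the polygon
lies in the closed half-plane to the left of the line from `z` to `w`. -/
def IsPolygonSide (V : Set ℂ) (z w : ℂ) : Prop :=
  z ∈ V ∧ w ∈ V ∧ z ≠ w ∧ ∀ v ∈ V, 0 ≤ (conj (w - z) * (v - z)).im

/-- The segment `[z, w]` is tangent to `C` at `p`: it meets `C` at `p` and nowhere else, and every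
tangent vector to `C` at `p` is parallel to `w - z`. -/
def SegmentTangentAt (C : Set ℂ) (z w p : ℂ) : Prop :=
  C ∩ segment ℝ z w = {p} ∧ ∀ v ∈ tangentConeAt ℝ C p, ∃ t : ℝ, v = t * (w - z)

/-- `C` is a Blaschke curve of `B`: a closed convex curve in the open unit disk (which may be
degenerate, that is, a single point) that is inscribed in each of the convex polygons with vertices
at the solutions on the unit circle of `B z = l`, `‖l‖ = 1`, and each point of which is a point of
tangency with a side of such a polygon. -/
structure IsBlaschkeCurve (B : ℂ → ℂ) (C : Set ℂ) : Prop where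
  /-- `C` is a closed convex curve or a point. -/
  convex_curve : ∃ K : Set ℂ, K.Nonempty ∧ IsCompact K ∧ Convex ℝ K ∧ C = frontier K
  /-- `C` lies in the open unit disk. -/
  subset_disk : C ⊆ Metric.ball (0 : ℂ) 1
  /-- `C` lies in every one of the polygons. -/
  subset_polygon : ∀ l : ℂ, ‖l‖ = 1 → C ⊆ convexHull ℝ (circleFiber B l)
  /-- Every side of every one of the polygons is tangent to `C`. -/
  side_tangent : ∀ l : ℂ, ‖l‖ = 1 → ∀ z w : ℂ, IsPolygonSide (circleFiber B l) z w →
    ∃ p, SegmentTangentAt C z w p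
  /-- Every point of `C` is a point of tangency. -/
  point_of_tangency : ∀ p ∈ C, ∃ l : ℂ, ‖l‖ = 1 ∧ ∃ z w : ℂ,
    IsPolygonSide (circleFiber B l) z w ∧ SegmentTangentAt C z w p

/-- A nondegenerate ellipse in the plane, given by its foci and the sum of the distances to them
(circles are included). -/
def IsEllipse (E : Set ℂ) : Prop :=
  ∃ (f g : ℂ) (s : ℝ), dist f g < s ∧ E = {z | dist z f + dist z g = s}

/-!
Post-composing `B` with the disk automorphism that takes its critical value to `0` makes `0` the
only critical value. A Blaschke product with two distinct zeros has a critical point off its zeros: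
the numerator of its logarithmic derivative is a self-reciprocal polynomial without roots on the
unit circle, so it has a root inside. Hence the new product is `η * φ_c ^ n` for a disk automorphism
`φ_c`, and the fibers of `B` on the unit circle are the images of regular `n`-gons under `φ_c⁻¹`.
On the circle, `φ_c` agrees with a projective map of the disk (the Klein model of the hyperbolic
plane). It takes chords to chords and conics to conics, so the polygons are circumscribed about the
preimage of the common incircle, of radius `cos (π / n)`, of these `n`-gons: an ellipse in the disk,
reduced to a point when `n = 2`.
-/

open Filter Topology Real

section StrictlyConvexLevelSets

variable {E : Type*} [NormedAddCommGroup E] [NormedSpace ℝ E] {f : E → ℝ}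

theorem frontier_sublevel_eq_level [Nontrivial E] (hf : StrictConvexOn ℝ Set.univ f)
    (hcont : Continuous f) (r : ℝ) : frontier {x | f x ≤ r} = {x | f x = r} := by
  refine (frontier_le_subset_eq hcont continuous_const).antisymm fun p hp => ?_
  rw [(isClosed_le hcont continuous_const).frontier_eq]
  refine ⟨le_of_eq hp, fun hinterior => ?_⟩
  obtain ⟨v, hv⟩ := exists_ne (0 : E)
  have htendsto (u : E) : Tendsto (fun t : ℝ => p + t • u) (𝓝[>] 0) (𝓝 p) := by
    have : Continuous fun t : ℝ => p + t • u := by fun_prop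
    simpa using (this.tendsto 0).mono_left nhdsWithin_le_nhds
  obtain ⟨t, hplus, hminus, ht⟩ := ((htendsto v).eventually (mem_interior_iff_mem_nhds.mp hinterior)
    |>.and <| ((htendsto (-v)).eventually (mem_interior_iff_mem_nhds.mp hinterior)).and
      self_mem_nhdsWithin).exists
  have hne : p + t • v ≠ p + t • -v := fun h =>
    smul_ne_zero (mul_pos two_pos ht).ne' hv (by linear_combination (norm := module) h)
  have hlt := hf.2 (Set.mem_univ (p + t • v)) (Set.mem_univ (p + t • -v)) hne
    one_half_pos one_half_pos (add_halves 1)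
  have hmid : (1 / 2 : ℝ) • (p + t • v) + (1 / 2 : ℝ) • (p + t • -v) = p := by module
  rw [hmid, smul_eq_mul, smul_eq_mul, show f p = r from hp] at hlt
  linarith [show f (p + t • v) ≤ r from hplus, show f (p + t • -v) ≤ r from hminus]

theorem tangentConeAt_singleton_subset_zero (p : E) : tangentConeAt ℝ {p} p ⊆ {0} :=
  tangentConeAt_subset_zero (fun h => by
    simpa using accPt_iff_frequently.mp h)

theorem fderiv_apply_eq_zero_of_mem_tangentConeAt_level {f' : E →L[ℝ] ℝ} {p v : E}
    (hf' : HasFDerivAt f f' p) (hv : v ∈ tangentConeAt ℝ {x | f x = f p} p) : f' v = 0 := by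
  have himage : f '' {x | f x = f p} ⊆ {f p} := by
    rintro _ ⟨x, hx, rfl⟩
    exact hx
  exact tangentConeAt_singleton_subset_zero _
    (tangentConeAt_mono himage (hf'.hasFDerivWithinAt.mapsTo_tangent_cone hv))

theorem isMinOn_univ_of_hasFDerivAt_zero (hf : ConvexOn ℝ Set.univ f) {p : E}
    (hf' : HasFDerivAt f (0 : E →L[ℝ] ℝ) p) : IsMinOn f Set.univ p := by
  intro x _
  have hline : ConvexOn ℝ Set.univ (f ∘ AffineMap.lineMap p x) :=
    hf.comp_affineMap (AffineMap.lineMap p x)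
  have hderiv : HasDerivAt (f ∘ AffineMap.lineMap p x) 0 (0 : ℝ) := by
    have hp : HasFDerivAt f (0 : E →L[ℝ] ℝ) (AffineMap.lineMap p x (0 : ℝ)) := by simpa using hf'
    simpa using hp.comp_hasDerivAt (0 : ℝ) AffineMap.hasDerivAt_lineMap
  have hmin := hline.isMinOn_of_rightDeriv_eq_zero (x := 0) (by simp)
    (hderiv.hasDerivWithinAt.derivWithin (uniqueDiffWithinAt_Ioi 0))
  simpa using hmin (Set.mem_univ 1)

theorem apply_sub_eq_zero_of_isMinOn_segment {f' : E →L[ℝ] ℝ} {z w p : E}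
    (hf' : HasFDerivAt f f' p) (hp : p ∈ openSegment ℝ z w)
    (hmin : IsMinOn f (segment ℝ z w) p) : f' (w - z) = 0 := by
  have hps := openSegment_subset_segment ℝ z w hp
  have hnonneg : ∀ x ∈ segment ℝ z w, 0 ≤ f' (x - p) := fun x hx =>
    hmin.localize.hasFDerivWithinAt_nonneg hf'.hasFDerivWithinAt
      (sub_mem_posTangentConeAt_of_segment_subset ((convex_segment z w).segment_subset hps hx))
  obtain ⟨s, t, hs, ht, hst, rfl⟩ := hp
  have hw := hnonneg w (right_mem_segment ℝ z w)
  have hz := hnonneg z (left_mem_segment ℝ z w)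
  obtain rfl : s = 1 - t := by linarith
  rw [show w - ((1 - t) • z + t • w) = (1 - t) • (w - z) by module, map_smul, smul_eq_mul] at hw
  rw [show z - ((1 - t) • z + t • w) = (-t) • (w - z) by module, map_smul, smul_eq_mul] at hz
  nlinarith [(mul_nonneg_iff_of_pos_left hs).mp hw]

end StrictlyConvexLevelSets

theorem exists_real_mul_eq_of_mem_ker {φ : ℂ →ₗ[ℝ] ℝ} (hφ : φ ≠ 0) {u v : ℂ} (hu : u ≠ 0)
    (hφu : φ u = 0) (hφv : φ v = 0) : ∃ t : ℝ, v = t * u := by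
  have hrank := Module.Dual.finrank_ker_add_one_of_ne_zero hφ
  rw [Complex.finrank_real_complex] at hrank
  obtain ⟨t, ht⟩ := (finrank_eq_one_iff_of_nonzero' (K := ℝ) (⟨u, hφu⟩ : LinearMap.ker φ)
    (by simpa [Subtype.ext_iff] using hu)).mp (by omega) ⟨v, hφv⟩
  exact ⟨t, by simpa using (congrArg Subtype.val ht).symm⟩

theorem segmentTangentAt_level {f : ℂ → ℝ} (hf : StrictConvexOn ℝ Set.univ f) {z w p : ℂ}
    (hd : DifferentiableAt ℝ f p) (hzw : z ≠ w) (hp : p ∈ openSegment ℝ z w)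
    (hmin : IsMinOn f (segment ℝ z w) p) : SegmentTangentAt {x | f x = f p} z w p := by
  have hps := openSegment_subset_segment ℝ z w hp
  refine ⟨Set.eq_singleton_iff_unique_mem.mpr ⟨⟨rfl, hps⟩, fun x ⟨hx, hxs⟩ => ?_⟩, fun v hv => ?_⟩
  · have hxmin : IsMinOn f (segment ℝ z w) x := fun y hy => (le_of_eq hx).trans (hmin hy)
    exact (hf.subset (Set.subset_univ _) (convex_segment z w)).eq_of_isMinOn hxmin hmin hxs hps
  · by_cases hzero : fderiv ℝ f p = 0
    · have hpmin := isMinOn_univ_of_hasFDerivAt_zero hf.convexOn (hzero ▸ hd.hasFDerivAt)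
      have hlevel : {x | f x = f p} ⊆ {p} := fun x hx => hf.eq_of_isMinOn
        (fun y hy => (le_of_eq hx).trans (hpmin hy)) hpmin (Set.mem_univ x) (Set.mem_univ p)
      have hv0 : v = 0 := tangentConeAt_singleton_subset_zero p (tangentConeAt_mono hlevel hv)
      exact ⟨0, by simpa using hv0⟩
    · exact exists_real_mul_eq_of_mem_ker (φ := (fderiv ℝ f p).toLinearMap)
        (fun h => hzero (ContinuousLinearMap.coe_injective h))
        (sub_ne_zero.mpr hzw.symm) (apply_sub_eq_zero_of_isMinOn_segment hd.hasFDerivAt hp hmin)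
        (fderiv_apply_eq_zero_of_mem_tangentConeAt_level hd.hasFDerivAt hv)

theorem inv_smul_mem_convexHull_image {E F : Type*} [AddCommGroup E] [Module ℝ E] [AddCommGroup F]
    [Module ℝ F] (N : E →ᵃ[ℝ] F) (L : E →ᵃ[ℝ] ℝ) {S : Set E} (hL : ∀ x ∈ S, 0 < L x) {x : E}
    (hx : x ∈ convexHull ℝ S) :
    (L x)⁻¹ • N x ∈ convexHull ℝ ((fun y => (L y)⁻¹ • N y) '' S) := by
  set K := convexHull ℝ ((fun y => (L y)⁻¹ • N y) '' S)
  have hconv : Convex ℝ {y | 0 < L y ∧ (L y)⁻¹ • N y ∈ K} := by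
    rintro y ⟨hLy, hy⟩ z ⟨hLz, hz⟩ s t hs ht hst
    have hL_eq : L (s • y + t • z) = s * L y + t * L z := Convex.combo_affine_apply hst
    have hpos : 0 < s * L y + t * L z := convex_Ioi (0 : ℝ) hLy hLz hs ht hst
    refine ⟨hL_eq ▸ hpos, ?_⟩
    convert (convex_convexHull ℝ _) hy hz (div_nonneg (mul_nonneg hs hLy.le) hpos.le)
      (div_nonneg (mul_nonneg ht hLz.le) hpos.le) (by rw [← add_div, div_self hpos.ne']) using 1
    rw [hL_eq, Convex.combo_affine_apply hst]
    match_scalars <;> field_simp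
  refine (convexHull_min (fun y hy => ?_) hconv hx).2
  exact ⟨hL y hy, subset_convexHull ℝ _ (Set.mem_image_of_mem _ hy)⟩

section RegularPolygon

variable {n k : ℕ}

/-- Twice the signed area of the triangle with vertices `z`, `w`, `v`. It is nonnegative exactly
when `v` lies in the closed half-plane to the left of the line from `z` to `w`, so it is the
quantity that decides which chords are sides of a convex polygon. -/
noncomputable def orient (z w v : ℂ) : ℝ := (conj (w - z) * (v - z)).im

theorem orient_mul_left (ζ z w v : ℂ) :
    orient (ζ * z) (ζ * w) (ζ * v) = ‖ζ‖ ^ 2 * orient z w v := by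
  have hζ : conj ζ * ζ = ((‖ζ‖ ^ 2 : ℝ) : ℂ) := by simpa using Complex.conj_mul' ζ
  rw [orient, orient, ← Complex.im_ofReal_mul, ← hζ]
  congr 1
  simp only [map_sub, map_mul]
  ring

theorem norm_eq_one_of_pow_eq (hn : n ≠ 0) {ζ μ : ℂ} (hμ : ‖μ‖ = 1) (hζ : ζ ^ n = μ) :
    ‖ζ‖ = 1 :=
  (pow_eq_one_iff_of_nonneg (norm_nonneg ζ) hn).mp (by rw [← norm_pow, hζ, hμ])

/-- The primitive `n`-th root of unity `exp (2 π i / n)`, the rotation that takes each vertex of a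
regular `n`-gon centred at `0` to the next one. -/
noncomputable def primRoot (n : ℕ) : ℂ := Complex.exp ((2 * (π / n) : ℝ) * Complex.I)

theorem isPrimitiveRoot_primRoot (hn : n ≠ 0) : IsPrimitiveRoot (primRoot n) n := by
  convert Complex.isPrimitiveRoot_exp n hn using 1
  rw [primRoot]
  congr 1
  push_cast
  ring

theorem norm_primRoot (n : ℕ) : ‖primRoot n‖ = 1 := Complex.norm_exp_ofReal_mul_I _

theorem primRoot_pow (n k : ℕ) :
    primRoot n ^ k = Complex.exp ((2 * (k * (π / n)) : ℝ) * Complex.I) := by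
  rw [primRoot, ← Complex.exp_nat_mul]
  congr 1
  push_cast
  ring

theorem orient_one_exp_exp (α β : ℝ) :
    orient 1 (Complex.exp ((2 * α : ℝ) * Complex.I)) (Complex.exp ((2 * β : ℝ) * Complex.I)) =
      4 * sin α * sin β * sin (β - α) := by
  simp only [orient, Complex.mul_im, Complex.conj_re, Complex.conj_im, Complex.sub_re,
    Complex.sub_im, Complex.exp_ofReal_mul_I_re, Complex.exp_ofReal_mul_I_im, Complex.one_re,
    Complex.one_im]
  rw [sin_sub, cos_two_mul, cos_two_mul, sin_two_mul, sin_two_mul]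
  linear_combination (4 * sin β * cos β) * sin_sq_add_cos_sq α -
    (4 * sin α * cos α) * sin_sq_add_cos_sq β

theorem orient_one_primRoot_pow (n j k : ℕ) :
    orient 1 (primRoot n ^ j) (primRoot n ^ k) =
      4 * sin (j * (π / n)) * sin (k * (π / n)) * sin (k * (π / n) - j * (π / n)) := by
  rw [primRoot_pow, primRoot_pow, orient_one_exp_exp]

theorem sin_nat_mul_pi_div_pos (hk : 0 < k) (hkn : k < n) : 0 < sin (k * (π / n)) := by
  have hk' : (0 : ℝ) < k := by exact_mod_cast hk
  have hkn' : (k : ℝ) < n := by exact_mod_cast hkn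
  have hn : (0 : ℝ) < n := hk'.trans hkn'
  refine sin_pos_of_pos_of_lt_pi (by positivity) ?_
  rw [mul_div_left_comm, mul_lt_iff_lt_one_right pi_pos, div_lt_one hn]
  exact hkn'

theorem exists_eq_mul_primRoot_pow (hn : n ≠ 0) {ζ v : ℂ} (hζ : ζ ≠ 0)
    (hv : v ^ n = ζ ^ n) : ∃ k < n, v = ζ * primRoot n ^ k := by
  have : NeZero n := ⟨hn⟩
  have hroot : (v / ζ) ^ n = 1 := by rw [div_pow, hv, div_self (pow_ne_zero n hζ)]
  obtain ⟨k, hkn, hk⟩ := (isPrimitiveRoot_primRoot hn).eq_pow_of_pow_eq_one hroot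
  exact ⟨k, hkn, by rw [hk, mul_div_cancel₀ _ hζ]⟩

theorem orient_one_primRoot_nonneg (hk : k < n) :
    0 ≤ orient 1 (primRoot n) (primRoot n ^ k) := by
  have h := orient_one_primRoot_pow n 1 k
  rw [pow_one, Nat.cast_one, one_mul] at h
  rw [h]
  rcases k with _ | _ | k
  · simp
  · simp
  · have hsin₁ := sin_nat_mul_pi_div_pos (n := n) one_pos (by omega)
    have hsin₂ := sin_nat_mul_pi_div_pos (n := n) (Nat.succ_pos (k + 1)) hk
    have hsin₃ := sin_nat_mul_pi_div_pos (n := n) k.succ_pos (by omega)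
    rw [Nat.cast_one, one_mul] at hsin₁
    have hsub : ((k + 1 + 1 : ℕ) : ℝ) * (π / n) - π / n = (k + 1 : ℕ) * (π / n) := by
      push_cast
      ring
    rw [hsub]
    positivity

theorem orient_one_primRoot_pow_neg (hk : 1 < k) (hkn : k < n) :
    orient 1 (primRoot n ^ k) (primRoot n) < 0 := by
  obtain ⟨k, rfl⟩ := Nat.exists_eq_add_of_lt hk
  have h := orient_one_primRoot_pow n (1 + k + 1) 1
  rw [pow_one, Nat.cast_one, one_mul] at h
  have hsub : π / n - ((1 + k + 1 : ℕ) : ℝ) * (π / n) = -((k + 1 : ℕ) * (π / n)) := by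
    push_cast
    ring
  rw [h, hsub, sin_neg, mul_neg, neg_lt_zero]
  have hsin₁ := sin_nat_mul_pi_div_pos (n := n) one_pos (by omega)
  rw [Nat.cast_one, one_mul] at hsin₁
  have hsin₂ := sin_nat_mul_pi_div_pos (zero_lt_one.trans hk) hkn
  have hsin₃ := sin_nat_mul_pi_div_pos (n := n) k.succ_pos (by omega)
  positivity

theorem isPolygonSide_nthRoots_iff (hn : 2 ≤ n) {μ : ℂ} (hμ : ‖μ‖ = 1) {ζ ξ : ℂ} :
    IsPolygonSide {u | u ^ n = μ} ζ ξ ↔ ζ ^ n = μ ∧ ξ = ζ * primRoot n := by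
  have hn0 : n ≠ 0 := by omega
  have hω := isPrimitiveRoot_primRoot hn0
  have hne {ζ : ℂ} (hζ : ζ ^ n = μ) : ζ ≠ 0 :=
    norm_ne_zero_iff.mp (norm_eq_one_of_pow_eq hn0 hμ hζ ▸ one_ne_zero)
  have horient {ζ : ℂ} (hζ : ζ ^ n = μ) (x y : ℂ) :
      orient ζ (ζ * x) (ζ * y) = orient 1 x y := by
    simpa [norm_eq_one_of_pow_eq hn0 hμ hζ] using orient_mul_left ζ 1 x y
  have hnext {ζ : ℂ} (hζ : ζ ^ n = μ) : (ζ * primRoot n) ^ n = μ := by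
    rw [mul_pow, hω.pow_eq_one, mul_one, hζ]
  constructor
  · rintro ⟨hζ, hξ, hζξ, hleft⟩
    obtain ⟨k, hkn, rfl⟩ := exists_eq_mul_primRoot_pow hn0 (hne hζ) (hξ.trans hζ.symm)
    refine ⟨hζ, ?_⟩
    rcases lt_trichotomy k 1 with hk | rfl | hk
    · simp [Nat.lt_one_iff.mp hk] at hζξ
    · rw [pow_one]
    · refine absurd ?_ (orient_one_primRoot_pow_neg hk hkn).not_ge
      rw [← horient hζ]
      exact hleft _ (hnext hζ)
  · rintro ⟨hζ, rfl⟩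
    refine ⟨hζ, hnext hζ, fun h => hω.ne_one hn (mul_left_cancel₀ (hne hζ) (by rw [← h, mul_one])),
      fun v hv => ?_⟩
    obtain ⟨k, hkn, rfl⟩ := exists_eq_mul_primRoot_pow hn0 (hne hζ) (hv.trans hζ.symm)
    exact (orient_one_primRoot_nonneg hkn).trans_eq (horient hζ _ _).symm

theorem inner_mul_primRoot {u : ℂ} (hu : ‖u‖ = 1) (n : ℕ) :
    inner ℝ u (u * primRoot n) = 1 - 2 * sin (π / n) ^ 2 := by
  rw [Complex.inner, mul_right_comm, Complex.mul_conj', hu, Complex.ofReal_one, one_pow, one_mul,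
    primRoot, Complex.exp_ofReal_mul_I_re, cos_two_mul, cos_sq']
  ring

theorem exists_midpoint_mul_primRoot_eq {q : ℂ} (hq : ‖q‖ = |cos (π / n)|) :
    ∃ u : ℂ, ‖u‖ = 1 ∧ midpoint ℝ u (u * primRoot n) = q := by
  obtain ⟨e, he, rfl⟩ : ∃ e : ℂ, ‖e‖ = 1 ∧ q = e * (cos (π / n) : ℝ) := by
    by_cases hcos : cos (π / n) = 0
    · exact ⟨1, norm_one, by simpa [hcos] using hq⟩
    · refine ⟨q / (cos (π / n) : ℝ), ?_, (div_mul_cancel₀ q (by exact_mod_cast hcos)).symm⟩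
      rw [norm_div, hq, Complex.norm_real, norm_eq_abs, div_self (abs_ne_zero.mpr hcos)]
  refine ⟨e * Complex.exp (-(π / n * Complex.I)), ?_, ?_⟩
  · rw [norm_mul, he, one_mul]
    simpa using Complex.norm_exp_ofReal_mul_I (-(π / n))
  · have hexp : Complex.exp (-(π / n * Complex.I)) * primRoot n =
        Complex.exp (π / n * Complex.I) := by
      rw [primRoot, ← Complex.exp_add]
      congr 1
      push_cast
      ring
    rw [mul_assoc, hexp, midpoint_eq_smul_add, invOf_eq_inv, Complex.real_smul,
      Complex.ofReal_cos, Complex.cos]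
    push_cast
    ring_nf

theorem mem_convexHull_of_forall_inner_le {E : Type*} [NormedAddCommGroup E]
    [InnerProductSpace ℝ E] [CompleteSpace E] {S : Set E} (hS : S.Finite) {q : E}
    (hq : ∀ e : E, ∃ v ∈ S, inner ℝ e q ≤ inner ℝ e v) : q ∈ convexHull ℝ S := by
  by_contra hnot
  obtain ⟨φ, r, hφS, hφq⟩ := geometric_hahn_banach_closed_point (convex_convexHull ℝ S)
    (hS.isClosed_convexHull ℝ) hnot
  obtain ⟨v, hv, hle⟩ := hq ((InnerProductSpace.toDual ℝ E).symm φ)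
  simp only [InnerProductSpace.toDual_symm_apply] at hle
  linarith [hφS v (subset_convexHull ℝ S hv)]

theorem exists_int_cos_pi_div_le (hn : n ≠ 0) (θ : ℝ) :
    ∃ k : ℤ, cos (π / n) ≤ cos (θ - k * (2 * π / n)) := by
  have hn' : (1 : ℝ) ≤ n := by exact_mod_cast Nat.one_le_iff_ne_zero.mpr hn
  have hstep : 0 < 2 * π / n := by positivity
  set k := round (θ / (2 * π / n))
  have hdist : |θ - k * (2 * π / n)| ≤ π / n := by
    have hfactor : θ - k * (2 * π / n) = (θ / (2 * π / n) - k) * (2 * π / n) := by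
      rw [sub_mul, div_mul_cancel₀ θ hstep.ne']
    calc |θ - k * (2 * π / n)| = |θ / (2 * π / n) - k| * (2 * π / n) := by
          rw [hfactor, abs_mul, abs_of_pos hstep]
      _ ≤ 1 / 2 * (2 * π / n) := by gcongr; exact abs_sub_round _
      _ = π / n := by ring
  refine ⟨k, ?_⟩
  rw [← cos_abs (θ - k * (2 * π / n))]
  exact cos_le_cos_of_nonneg_of_le_pi (abs_nonneg _) (div_le_self pi_pos.le hn') hdist

theorem exists_pow_eq_and_norm_mul_cos_le_inner (hn : n ≠ 0) {μ : ℂ} (hμ : ‖μ‖ = 1)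
    (e : ℂ) : ∃ v : ℂ, v ^ n = μ ∧ ‖e‖ * cos (π / n) ≤ inner ℝ e v := by
  obtain ⟨ν, hν⟩ := IsAlgClosed.exists_pow_nat_eq μ (Nat.pos_of_ne_zero hn)
  obtain ⟨k, hk⟩ := exists_int_cos_pi_div_le hn (conj e * ν).arg
  refine ⟨ν * Complex.exp ((-(k * (2 * π / n)) : ℝ) * Complex.I), ?_, ?_⟩
  · have hn' : (n : ℂ) ≠ 0 := by exact_mod_cast hn
    have harg : (n : ℂ) * ((-(k * (2 * π / n)) : ℝ) * Complex.I) =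
        ((-k : ℤ) : ℂ) * (2 * π * Complex.I) := by
      push_cast
      field_simp
    rw [mul_pow, hν, ← Complex.exp_nat_mul, harg, Complex.exp_int_mul_two_pi_mul_I, mul_one]
  · have hnorm : ‖conj e * ν‖ = ‖e‖ := by
      rw [norm_mul, Complex.norm_conj, norm_eq_one_of_pow_eq hn hμ hν, mul_one]
    rw [Complex.inner, mul_comm _ (conj e), ← mul_assoc,
      ← Complex.norm_mul_exp_arg_mul_I (conj e * ν), hnorm, mul_assoc, ← Complex.exp_add,
      ← add_mul, ← Complex.ofReal_add, Complex.re_ofReal_mul, Complex.exp_ofReal_mul_I_re]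
    exact mul_le_mul_of_nonneg_left hk (norm_nonneg e)

theorem mem_convexHull_nthRoots (hn : n ≠ 0) {μ : ℂ} (hμ : ‖μ‖ = 1) {q : ℂ}
    (hq : ‖q‖ ≤ cos (π / n)) : q ∈ convexHull ℝ {v : ℂ | v ^ n = μ} := by
  have hfin : {v : ℂ | v ^ n = μ}.Finite := by
    refine (Polynomial.nthRoots n μ).toFinset.finite_toSet.subset fun v hv => ?_
    simpa [Polynomial.mem_nthRoots (Nat.pos_of_ne_zero hn)] using hv
  refine mem_convexHull_of_forall_inner_le hfin fun e => ?_
  obtain ⟨v, hv, hle⟩ := exists_pow_eq_and_norm_mul_cos_le_inner hn hμ e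
  refine ⟨v, hv, le_trans ?_ hle⟩
  exact (real_inner_le_norm e q).trans (mul_le_mul_of_nonneg_left hq (norm_nonneg e))

end RegularPolygon

section DiskMobius

variable {c z : ℂ}

/-- The automorphism `z ↦ (z - c) / (1 - conj c z)` of the unit disk that takes `c` to `0`: the
Blaschke factor with zero `c`. -/
noncomputable def diskMobius (c z : ℂ) : ℂ := (z - c) / (1 - conj c * z)

theorem diskMobius_self (c : ℂ) : diskMobius c c = 0 := by simp [diskMobius]

theorem blaschkeProduct_eq_mul_prod_diskMobius {n : ℕ} (γ : ℂ) (a : Fin n → ℂ) (z : ℂ) :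
    blaschkeProduct γ a z = γ * ∏ j, diskMobius (a j) z := rfl

theorem one_sub_conj_mul_ne_zero (hc : ‖c‖ < 1) (hz : ‖z‖ ≤ 1) :
    1 - conj c * z ≠ 0 := by
  have hlt : ‖conj c * z‖ < 1 := by
    rw [norm_mul, Complex.norm_conj]
    exact mul_lt_one_of_nonneg_of_lt_one_left (norm_nonneg c) hc hz
  exact sub_ne_zero.mpr fun h => by simp [← h] at hlt

theorem norm_one_sub_conj_mul_sq_sub_norm_sub_sq (c z : ℂ) :
    ‖1 - conj c * z‖ ^ 2 - ‖z - c‖ ^ 2 = (1 - ‖c‖ ^ 2) * (1 - ‖z‖ ^ 2) := by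
  simp only [Complex.sq_norm, Complex.normSq_apply, Complex.sub_re, Complex.sub_im,
    Complex.one_re, Complex.one_im, Complex.mul_re, Complex.mul_im, Complex.conj_re,
    Complex.conj_im]
  ring

theorem one_sub_norm_sq_pos (hc : ‖c‖ < 1) : 0 < 1 - ‖c‖ ^ 2 :=
  sub_pos.mpr (pow_lt_one₀ (norm_nonneg c) hc two_ne_zero)

theorem norm_one_sub_conj_mul_le_norm_sub (hc : ‖c‖ < 1) (hz : 1 ≤ ‖z‖) :
    ‖1 - conj c * z‖ ≤ ‖z - c‖ := by
  refine le_of_sq_le_sq ?_ (norm_nonneg _)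
  rw [← sub_nonpos, norm_one_sub_conj_mul_sq_sub_norm_sub_sq]
  exact mul_nonpos_of_nonneg_of_nonpos (one_sub_norm_sq_pos hc).le
    (sub_nonpos.mpr (one_le_pow₀ hz))

theorem norm_diskMobius_eq_one (hc : ‖c‖ < 1) (hz : ‖z‖ = 1) : ‖diskMobius c z‖ = 1 := by
  have h := norm_one_sub_conj_mul_sq_sub_norm_sub_sq c z
  rw [hz, one_pow, sub_self, mul_zero, sub_eq_zero] at h
  rw [diskMobius, norm_div, ← (pow_left_inj₀ (norm_nonneg _) (norm_nonneg _) two_ne_zero).mp h,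
    div_self (norm_ne_zero_iff.mpr (one_sub_conj_mul_ne_zero hc hz.le))]

theorem norm_diskMobius_lt_one (hc : ‖c‖ < 1) (hz : ‖z‖ < 1) : ‖diskMobius c z‖ < 1 := by
  rw [diskMobius, norm_div, div_lt_one (norm_pos_iff.mpr (one_sub_conj_mul_ne_zero hc hz.le))]
  refine lt_of_pow_lt_pow_left₀ 2 (norm_nonneg _) (sub_pos.mp ?_)
  rw [norm_one_sub_conj_mul_sq_sub_norm_sub_sq]
  exact mul_pos (one_sub_norm_sq_pos hc) (one_sub_norm_sq_pos hz)

theorem diskMobius_neg_diskMobius (hc : ‖c‖ < 1) (hz : ‖z‖ ≤ 1) :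
    diskMobius (-c) (diskMobius c z) = z := by
  have hcz := one_sub_conj_mul_ne_zero hc hz
  have hcc := one_sub_conj_mul_ne_zero hc hc.le
  have hden : 1 - conj (-c) * diskMobius c z = (1 - conj c * c) / (1 - conj c * z) := by
    rw [diskMobius, map_neg]
    field_simp
    ring
  have hnum : diskMobius c z - -c = z * (1 - conj c * c) / (1 - conj c * z) := by
    rw [diskMobius, eq_div_iff hcz, sub_neg_eq_add, add_mul, div_mul_cancel₀ _ hcz]
    ring
  rw [diskMobius, hden, hnum, div_div_div_cancel_right₀ hcz, mul_div_cancel_right₀ z hcc]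

theorem hasDerivAt_diskMobius (h : 1 - conj c * z ≠ 0) :
    HasDerivAt (diskMobius c) ((1 - ‖c‖ ^ 2 : ℝ) / (1 - conj c * z) ^ 2) z := by
  have hnum : HasDerivAt (fun z => z - c) 1 z := (hasDerivAt_id z).sub_const c
  have hden : HasDerivAt (fun z => 1 - conj c * z) (-conj c) z := by
    simpa using ((hasDerivAt_id z).const_mul (conj c)).const_sub 1
  refine (hnum.div hden h).congr_deriv ?_
  push_cast
  rw [← Complex.conj_mul']
  ring

theorem deriv_diskMobius_ne_zero (hc : ‖c‖ < 1) (hz : ‖z‖ ≤ 1) :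
    deriv (diskMobius c) z ≠ 0 := by
  have h := one_sub_conj_mul_ne_zero hc hz
  rw [(hasDerivAt_diskMobius h).deriv]
  exact div_ne_zero (by exact_mod_cast (one_sub_norm_sq_pos hc).ne') (pow_ne_zero 2 h)

end DiskMobius

section BlaschkeProduct

variable {n : ℕ} {γ : ℂ} {a : Fin n → ℂ}

theorem norm_blaschkeProduct_eq_one (hγ : ‖γ‖ = 1) (ha : ∀ j, ‖a j‖ < 1) {z : ℂ} (hz : ‖z‖ = 1) :
    ‖blaschkeProduct γ a z‖ = 1 := by
  rw [blaschkeProduct_eq_mul_prod_diskMobius, norm_mul, hγ, one_mul, norm_prod]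
  exact Finset.prod_eq_one fun j _ => norm_diskMobius_eq_one (ha j) hz

theorem norm_blaschkeProduct_lt_one (hn : n ≠ 0) (hγ : ‖γ‖ = 1) (ha : ∀ j, ‖a j‖ < 1) {z : ℂ}
    (hz : ‖z‖ < 1) : ‖blaschkeProduct γ a z‖ < 1 := by
  obtain ⟨k, rfl⟩ := Nat.exists_eq_succ_of_ne_zero hn
  rw [blaschkeProduct_eq_mul_prod_diskMobius, norm_mul, hγ, one_mul, Fin.prod_univ_succ, norm_mul,
    norm_prod]
  exact mul_lt_one_of_nonneg_of_lt_one_left (norm_nonneg _) (norm_diskMobius_lt_one (ha 0) hz)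
    (Finset.prod_le_one (fun _ _ => norm_nonneg _)
      fun j _ => (norm_diskMobius_lt_one (ha j.succ) hz).le)

theorem differentiableAt_blaschkeProduct (γ : ℂ) (ha : ∀ j, ‖a j‖ < 1) {z : ℂ} (hz : ‖z‖ ≤ 1) :
    DifferentiableAt ℂ (blaschkeProduct γ a) z :=
  (DifferentiableAt.fun_finsetProd fun j _ => (hasDerivAt_diskMobius
    (one_sub_conj_mul_ne_zero (ha j) hz)).differentiableAt).const_mul γ

theorem logDeriv_blaschkeProduct (hγ : γ ≠ 0) (ha : ∀ j, ‖a j‖ < 1) {z : ℂ} (hz : ‖z‖ ≤ 1)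
    (hza : ∀ j, z ≠ a j) :
    logDeriv (blaschkeProduct γ a) z =
      ∑ j, ((1 - ‖a j‖ ^ 2 : ℝ) : ℂ) / ((z - a j) * (1 - conj (a j) * z)) := by
  have hden j := one_sub_conj_mul_ne_zero (ha j) hz
  have hnum j := sub_ne_zero.mpr (hza j)
  calc logDeriv (blaschkeProduct γ a) z
      = logDeriv (fun z => ∏ j, diskMobius (a j) z) z := logDeriv_const_mul z γ hγ
    _ = ∑ j, logDeriv (diskMobius (a j)) z :=
        logDeriv_prod (fun j _ => div_ne_zero (hnum j) (hden j))
          fun j _ => (hasDerivAt_diskMobius (hden j)).differentiableAt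
    _ = _ := by
        refine Finset.sum_congr rfl fun j _ => ?_
        have := hden j
        have := hnum j
        rw [logDeriv_apply, (hasDerivAt_diskMobius (hden j)).deriv, diskMobius]
        field_simp

theorem two_le_of_criticalValues_nonempty (hγ : ‖γ‖ = 1) (ha : ∀ j, ‖a j‖ < 1)
    (h : (criticalValues (blaschkeProduct γ a)).Nonempty) : 2 ≤ n := by
  obtain ⟨w, hw, z, hz, hderiv, rfl⟩ := h
  rw [mem_ball_zero_iff] at hw hz
  rcases n with _ | _ | n
  · simp [blaschkeProduct, hγ] at hw
  · have hB : blaschkeProduct γ a = fun z => γ * diskMobius (a 0) z :=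
      funext fun z => by simp [blaschkeProduct_eq_mul_prod_diskMobius]
    rw [hB, deriv_const_mul_field] at hderiv
    have hγ0 : γ ≠ 0 := norm_ne_zero_iff.mp (hγ ▸ one_ne_zero)
    exact absurd hderiv (mul_ne_zero hγ0 (deriv_diskMobius_ne_zero (ha 0) hz.le))
  · omega

end BlaschkeProduct

section CriticalPoints

open Polynomial

theorem exists_isRoot_norm_lt_one {p : ℂ[X]} {N : ℕ} (hN : N ≠ 0)
    (hrefl : ∀ z : ℂ, z ≠ 0 → z ^ N * conj (p.eval (conj z⁻¹)) = p.eval z)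
    (hcircle : ∀ z : ℂ, ‖z‖ = 1 → p.eval z ≠ 0) : ∃ z, ‖z‖ < 1 ∧ p.IsRoot z := by
  by_contra! hdisk
  have hnone : ∀ z, p.eval z ≠ 0 := by
    intro z hz
    rcases lt_trichotomy ‖z‖ 1 with hlt | heq | hgt
    · exact hdisk z hlt hz
    · exact hcircle z heq hz
    · have hz0 : z ≠ 0 := norm_pos_iff.mp (zero_lt_one.trans hgt)
      rw [← hrefl z hz0, mul_eq_zero, map_eq_zero] at hz
      refine hdisk _ ?_ (hz.resolve_left (pow_ne_zero N hz0))
      rw [Complex.norm_conj, norm_inv]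
      exact inv_lt_one_of_one_lt₀ hgt
  have hdeg : p.degree = 0 := by
    by_contra hdeg
    obtain ⟨z, hz⟩ := IsAlgClosed.exists_root p hdeg
    exact hnone z hz
  rw [eq_C_of_degree_eq_zero hdeg] at hnone hrefl
  have htwo := congrArg norm (hrefl 2 two_ne_zero)
  simp only [eval_C, norm_mul, norm_pow, Complex.norm_conj, Complex.norm_ofNat] at htwo hnone
  have hlt : (1 : ℝ) < 2 ^ N := one_lt_pow₀ one_lt_two hN
  exact hlt.ne' ((mul_eq_right₀ (norm_ne_zero_iff.mpr (hnone 0))).mp htwo)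

/-- The numerator of the sum of simple fractions `∑ m s / ((z - s) (1 - conj s z))` over the
denominator `∏ (z - s) (1 - conj s z)`. Up to the weights `m`, such sums are the logarithmic
derivatives of Blaschke products with zeros in `S`. -/
noncomputable def fractionSumNumerator (S : Finset ℂ) (m : ℂ → ℝ) : ℂ[X] :=
  ∑ s ∈ S, C (m s : ℂ) * ∏ t ∈ S.erase s, ((X - C t) * (1 - C (conj t) * X))

variable {S : Finset ℂ} {m : ℂ → ℝ}

theorem eval_fractionSumNumerator (S : Finset ℂ) (m : ℂ → ℝ) (z : ℂ) :
    (fractionSumNumerator S m).eval z =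
      ∑ s ∈ S, (m s : ℂ) * ∏ t ∈ S.erase s, ((z - t) * (1 - conj t * z)) := by
  simp [fractionSumNumerator, eval_finsetSum, eval_prod]

theorem eval_fractionSumNumerator_ne_zero_of_mem (hS : ∀ s ∈ S, ‖s‖ < 1) {s : ℂ} (hs : s ∈ S)
    (hm : m s ≠ 0) : (fractionSumNumerator S m).eval s ≠ 0 := by
  rw [eval_fractionSumNumerator, Finset.sum_eq_single_of_mem s hs]
  · refine mul_ne_zero (by exact_mod_cast hm) (Finset.prod_ne_zero_iff.mpr fun t ht => ?_)
    obtain ⟨hts, htS⟩ := Finset.mem_erase.mp ht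
    exact mul_ne_zero (sub_ne_zero.mpr hts.symm)
      (one_sub_conj_mul_ne_zero (hS t htS) (hS s hs).le)
  · intro t _ hts
    rw [Finset.prod_eq_zero (Finset.mem_erase.mpr ⟨hts.symm, hs⟩) (by simp), mul_zero]

theorem sub_mul_one_sub_conj_mul_of_norm_eq_one (t : ℂ) {z : ℂ} (hz : ‖z‖ = 1) :
    (z - t) * (1 - conj t * z) = z * (‖z - t‖ ^ 2 : ℝ) := by
  have hzz : conj z * z = 1 := by rw [Complex.conj_mul', hz]; norm_num
  push_cast
  rw [← Complex.mul_conj', map_sub]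
  linear_combination (t - z) * hzz

theorem eval_fractionSumNumerator_ne_zero_of_norm_eq_one (hS : ∀ s ∈ S, ‖s‖ < 1)
    (hm : ∀ s ∈ S, 0 < m s) (hne : S.Nonempty) {z : ℂ} (hz : ‖z‖ = 1) :
    (fractionSumNumerator S m).eval z ≠ 0 := by
  have heval : (fractionSumNumerator S m).eval z = z ^ (S.card - 1) *
      ((∑ s ∈ S, m s * ∏ t ∈ S.erase s, ‖z - t‖ ^ 2 : ℝ) : ℂ) := by
    rw [eval_fractionSumNumerator, Complex.ofReal_sum, Finset.mul_sum]
    refine Finset.sum_congr rfl fun s hs => ?_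
    simp_rw [sub_mul_one_sub_conj_mul_of_norm_eq_one _ hz]
    rw [Finset.prod_mul_distrib, Finset.prod_const, Finset.card_erase_of_mem hs]
    push_cast
    ring
  have hpos : 0 < ∑ s ∈ S, m s * ∏ t ∈ S.erase s, ‖z - t‖ ^ 2 := by
    refine Finset.sum_pos (fun s hs => mul_pos (hm s hs) (Finset.prod_pos fun t ht => ?_)) hne
    have hzt : z ≠ t := fun h => (hS t (Finset.mem_of_mem_erase ht)).ne (h ▸ hz)
    exact pow_pos (norm_pos_iff.mpr (sub_ne_zero.mpr hzt)) 2
  rw [heval]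
  exact mul_ne_zero (pow_ne_zero _ (norm_ne_zero_iff.mp (hz ▸ one_ne_zero)))
    (by exact_mod_cast hpos.ne')

theorem eval_fractionSumNumerator_reflect (S : Finset ℂ) (m : ℂ → ℝ) {z : ℂ} (hz : z ≠ 0) :
    z ^ (2 * (S.card - 1)) * conj ((fractionSumNumerator S m).eval (conj z⁻¹)) =
      (fractionSumNumerator S m).eval z := by
  rw [eval_fractionSumNumerator, eval_fractionSumNumerator, map_sum, Finset.mul_sum]
  refine Finset.sum_congr rfl fun s hs => ?_
  rw [map_mul, map_prod, Complex.conj_ofReal, mul_left_comm, ← Finset.card_erase_of_mem hs,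
    pow_mul, ← Finset.prod_const, ← Finset.prod_mul_distrib]
  congr 1
  refine Finset.prod_congr rfl fun t _ => ?_
  simp only [map_mul, map_sub, map_one, Complex.conj_conj]
  field_simp

theorem exists_sum_div_eq_zero (hS : ∀ s ∈ S, ‖s‖ < 1) (hm : ∀ s ∈ S, 0 < m s)
    (hcard : 2 ≤ S.card) :
    ∃ z, ‖z‖ < 1 ∧ z ∉ S ∧ ∑ s ∈ S, (m s : ℂ) / ((z - s) * (1 - conj s * z)) = 0 := by
  obtain ⟨z, hz, hroot⟩ := exists_isRoot_norm_lt_one (by omega)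
    (fun z hz => eval_fractionSumNumerator_reflect S m hz)
    (fun z hz => eval_fractionSumNumerator_ne_zero_of_norm_eq_one hS hm
      (Finset.card_pos.mp (by omega)) hz)
  have hzS : z ∉ S := fun h => eval_fractionSumNumerator_ne_zero_of_mem hS h (hm z h).ne' hroot
  have hfactor : ∀ t ∈ S, (z - t) * (1 - conj t * z) ≠ 0 := fun t ht =>
    mul_ne_zero (sub_ne_zero.mpr fun h => hzS (h ▸ ht)) (one_sub_conj_mul_ne_zero (hS t ht) hz.le)
  refine ⟨z, hz, hzS, (mul_eq_zero.mp ?_).resolve_left (Finset.prod_ne_zero_iff.mpr hfactor)⟩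
  rw [Finset.mul_sum, ← hroot.eq_zero, eval_fractionSumNumerator]
  refine Finset.sum_congr rfl fun s hs => ?_
  rw [← Finset.mul_prod_erase S _ hs, mul_comm, div_mul_eq_mul_div, div_eq_iff (hfactor s hs)]
  ring

theorem exists_deriv_blaschkeProduct_eq_zero {n : ℕ} {η : ℂ} (hη : η ≠ 0) {b : Fin n → ℂ}
    (hb : ∀ j, ‖b j‖ < 1) {i j : Fin n} (hij : b i ≠ b j) :
    ∃ z, ‖z‖ < 1 ∧ blaschkeProduct η b z ≠ 0 ∧ deriv (blaschkeProduct η b) z = 0 := by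
  obtain ⟨z, hz, hzb, hsum⟩ := exists_sum_div_eq_zero (S := Finset.univ.image b)
    (m := fun s => (Finset.univ.filter fun j => b j = s).card * (1 - ‖s‖ ^ 2)) (by simpa using hb)
    (fun s hs => by
      obtain ⟨j, -, rfl⟩ := Finset.mem_image.mp hs
      exact mul_pos (Nat.cast_pos.mpr (Finset.card_pos.mpr ⟨j, by simp⟩))
        (one_sub_norm_sq_pos (hb j)))
    (Finset.one_lt_card.mpr ⟨b i, by simp, b j, by simp, hij⟩)
  have hne : ∀ j, z ≠ b j := fun j h => hzb (by simp [h])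
  have hvalue : blaschkeProduct η b z ≠ 0 :=
    mul_ne_zero hη (Finset.prod_ne_zero_iff.mpr fun j _ =>
      div_ne_zero (sub_ne_zero.mpr (hne j)) (one_sub_conj_mul_ne_zero (hb j) hz.le))
  have hlog : logDeriv (blaschkeProduct η b) z = 0 := by
    rw [logDeriv_blaschkeProduct hη hb hz.le hne, Finset.sum_comp
      (fun s => ((1 - ‖s‖ ^ 2 : ℝ) : ℂ) / ((z - s) * (1 - conj s * z))) b, ← hsum]
    refine Finset.sum_congr rfl fun s _ => ?_
    rw [nsmul_eq_mul, mul_div_assoc', Complex.ofReal_mul, Complex.ofReal_natCast]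
  exact ⟨z, hz, hvalue, (div_eq_zero_iff.mp hlog).resolve_right hvalue⟩

theorem eq_of_criticalValues_blaschkeProduct_subset_zero {n : ℕ} {η : ℂ} (hη : ‖η‖ = 1)
    {b : Fin n → ℂ} (hb : ∀ j, ‖b j‖ < 1) (h : criticalValues (blaschkeProduct η b) ⊆ {0})
    (i j : Fin n) : b i = b j := by
  by_contra hij
  obtain ⟨z, hz, hvalue, hderiv⟩ :=
    exists_deriv_blaschkeProduct_eq_zero (norm_ne_zero_iff.mp (hη ▸ one_ne_zero)) hb hij
  exact hvalue (h ⟨mem_ball_zero_iff.mpr (norm_blaschkeProduct_lt_one (Fin.pos i).ne' hη hb hz),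
    z, mem_ball_zero_iff.mpr hz, hderiv, rfl⟩)

end CriticalPoints

section Postcomposition

open Polynomial

theorem exists_eq_C_mul_prod_X_sub_C {K : Type*} [Field K] [IsAlgClosed K] {n : ℕ} {p : K[X]}
    (hp : p.natDegree = n) : ∃ b : Fin n → K, p = C p.leadingCoeff * ∏ j, (X - C (b j)) := by
  have hsplits := IsAlgClosed.splits p
  have hlength : p.roots.toList.length = n := by
    rw [Multiset.length_toList, ← hsplits.natDegree_eq_card_roots, hp]
  subst hlength
  refine ⟨p.roots.toList.get, hsplits.eq_prod_roots.trans (congrArg _ ?_)⟩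
  rw [← List.prod_ofFn, ← Multiset.coe_toList p.roots, Multiset.map_coe, Multiset.prod_coe,
    Multiset.coe_toList]
  exact congrArg List.prod (List.ofFn_getElem_eq_map _ _).symm

theorem pow_mul_prod_inv_sub {K : Type*} [Field K] {n : ℕ} (d : Fin n → K) {z : K} (hz : z ≠ 0) :
    z ^ n * ∏ j, (z⁻¹ - d j) = ∏ j, (1 - d j * z) := by
  rw [← Fin.prod_const, ← Finset.prod_mul_distrib]
  exact Finset.prod_congr rfl fun j _ => by rw [mul_sub, mul_inv_cancel₀ hz, mul_comm]

theorem pow_mul_prod_one_sub_mul_inv {K : Type*} [Field K] {n : ℕ} (d : Fin n → K) {z : K}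
    (hz : z ≠ 0) : z ^ n * ∏ j, (1 - d j * z⁻¹) = ∏ j, (z - d j) := by
  rw [← pow_mul_prod_inv_sub d (inv_ne_zero hz), inv_inv, ← mul_assoc, ← mul_pow,
    mul_inv_cancel₀ hz, one_pow, one_mul]

/-- The numerator of `blaschkeProduct γ a - w` over the denominator `∏ⱼ (1 - conj aⱼ z)`. -/
noncomputable def shiftedNumerator {n : ℕ} (γ : ℂ) (a : Fin n → ℂ) (w : ℂ) : ℂ[X] :=
  C γ * ∏ j, (X - C (a j)) - C w * ∏ j, (1 - C (conj (a j)) * X)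

variable {n : ℕ} {γ w : ℂ} {a : Fin n → ℂ}

theorem eval_shiftedNumerator (γ : ℂ) (a : Fin n → ℂ) (w z : ℂ) :
    (shiftedNumerator γ a w).eval z =
      γ * ∏ j, (z - a j) - w * ∏ j, (1 - conj (a j) * z) := by
  simp [shiftedNumerator, eval_prod]

theorem natDegree_shiftedNumerator (hγ : ‖γ‖ = 1) (ha : ∀ j, ‖a j‖ < 1) (hw : ‖w‖ < 1) :
    (shiftedNumerator γ a w).natDegree = n := by
  have hdeg₁ j : (X - C (a j)).natDegree ≤ 1 := (natDegree_X_sub_C (a j)).le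
  have hdeg₂ j : (1 - C (conj (a j)) * X).natDegree ≤ 1 := by compute_degree
  have hdeg {f : Fin n → ℂ[X]} (hf : ∀ j, (f j).natDegree ≤ 1) (c : ℂ) :
      (C c * ∏ j, f j).natDegree ≤ n :=
    (natDegree_C_mul_le _ _).trans <| (natDegree_prod_le _ _).trans <|
      (Finset.sum_le_sum fun j _ => hf j).trans (by simp)
  have hcoeff : (shiftedNumerator γ a w).coeff n = γ - w * ∏ j, (-conj (a j)) := by
    have h₁ := coeff_prod_of_natDegree_le (s := Finset.univ) _ 1 fun j _ => hdeg₁ j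
    have h₂ := coeff_prod_of_natDegree_le (s := Finset.univ) _ 1 fun j _ => hdeg₂ j
    simp only [Finset.card_univ, Fintype.card_fin, mul_one] at h₁ h₂
    rw [shiftedNumerator, coeff_sub, coeff_C_mul, coeff_C_mul, h₁, h₂]
    simp [coeff_one, coeff_C]
  refine natDegree_eq_of_le_of_coeff_ne_zero
    ((natDegree_sub_le _ _).trans (max_le (hdeg hdeg₁ γ) (hdeg hdeg₂ w))) ?_
  rw [hcoeff, sub_ne_zero]
  intro h
  have hlt : ‖w * ∏ j, -conj (a j)‖ < 1 := by
    rw [norm_mul, norm_prod]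
    refine mul_lt_one_of_nonneg_of_lt_one_left (norm_nonneg w) hw
      (Finset.prod_le_one (fun _ _ => norm_nonneg _) fun j _ => ?_)
    rw [norm_neg, Complex.norm_conj]
    exact (ha j).le
  exact hlt.ne (h ▸ hγ)

theorem norm_lt_one_of_eval_shiftedNumerator_eq_zero (hγ : ‖γ‖ = 1) (ha : ∀ j, ‖a j‖ < 1)
    (hw : ‖w‖ < 1) {z : ℂ} (hz : (shiftedNumerator γ a w).eval z = 0) : ‖z‖ < 1 := by
  by_contra! h
  rw [eval_shiftedNumerator, sub_eq_zero] at hz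
  have hle : ‖∏ j, (1 - conj (a j) * z)‖ ≤ ‖∏ j, (z - a j)‖ := by
    rw [norm_prod, norm_prod]
    exact Finset.prod_le_prod (fun _ _ => norm_nonneg _)
      fun j _ => norm_one_sub_conj_mul_le_norm_sub (ha j) h
  have hpos : 0 < ‖∏ j, (z - a j)‖ := by
    rw [norm_pos_iff, Finset.prod_ne_zero_iff]
    exact fun j _ => sub_ne_zero.mpr fun hj => (ha j).not_ge (hj ▸ h)
  have hnorm : ‖∏ j, (z - a j)‖ = ‖w‖ * ‖∏ j, (1 - conj (a j) * z)‖ := by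
    simpa only [norm_mul, hγ, one_mul] using congrArg norm hz
  have hlt := calc
    ‖∏ j, (z - a j)‖ ≤ ‖w‖ * ‖∏ j, (z - a j)‖ := hnorm.trans_le (by gcongr)
    _ < 1 * ‖∏ j, (z - a j)‖ := by gcongr
  exact hlt.ne (one_mul _).symm

theorem exists_shiftedNumerator_eq_prod (hγ : ‖γ‖ = 1) (ha : ∀ j, ‖a j‖ < 1) (hw : ‖w‖ < 1) :
    ∃ (l : ℂ) (b : Fin n → ℂ), l ≠ 0 ∧ (∀ j, ‖b j‖ < 1) ∧
      ∀ z, γ * ∏ j, (z - a j) - w * ∏ j, (1 - conj (a j) * z) = l * ∏ j, (z - b j) := by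
  have hdeg := natDegree_shiftedNumerator hγ ha hw
  obtain ⟨b, hb⟩ := exists_eq_C_mul_prod_X_sub_C hdeg
  have heval z : (shiftedNumerator γ a w).eval z =
      (shiftedNumerator γ a w).leadingCoeff * ∏ j, (z - b j) := by
    simpa [eval_prod] using congrArg (eval z) hb
  refine ⟨_, b, fun hl => ?_, fun j => ?_, fun z => by rw [← eval_shiftedNumerator, heval z]⟩
  · have h0 := leadingCoeff_eq_zero.mp hl
    rw [h0, natDegree_zero] at hdeg
    subst hdeg
    have h1 := eval_shiftedNumerator γ a w 0
    simp only [h0, eval_zero, Finset.univ_eq_empty, Finset.prod_empty, mul_one] at h1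
    exact hw.ne (sub_eq_zero.mp h1.symm ▸ hγ)
  · refine norm_lt_one_of_eval_shiftedNumerator_eq_zero hγ ha hw ?_
    rw [heval, Finset.prod_eq_zero (Finset.mem_univ j) (sub_self _), mul_zero]

-- Conjugate the given identity at the reflected point `1 / conj z`.
theorem shiftedDenominator_eq_prod {b : Fin n → ℂ} {l : ℂ} (hγ : ‖γ‖ = 1)
    (h : ∀ z, γ * ∏ j, (z - a j) - w * ∏ j, (1 - conj (a j) * z) = l * ∏ j, (z - b j)) (z : ℂ) :
    ∏ j, (1 - conj (a j) * z) - conj w * (γ * ∏ j, (z - a j)) =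
      γ * conj l * ∏ j, (1 - conj (b j) * z) := by
  have hcont₁ : Continuous fun z : ℂ =>
      ∏ j, (1 - conj (a j) * z) - conj w * (γ * ∏ j, (z - a j)) := by fun_prop
  have hcont₂ : Continuous fun z : ℂ => γ * conj l * ∏ j, (1 - conj (b j) * z) := by fun_prop
  refine congrFun (hcont₁.ext_on (dense_compl_singleton (0 : ℂ)) hcont₂ fun z hz => ?_) z
  have hconj := congrArg conj (h (conj z⁻¹))
  simp only [map_sub, map_mul, map_prod, Complex.conj_conj, map_one] at hconj
  have hγγ : conj γ * γ = 1 := by rw [Complex.conj_mul', hγ]; norm_num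
  dsimp only
  rw [← pow_mul_prod_inv_sub (fun j => conj (a j)) hz,
    ← pow_mul_prod_inv_sub (fun j => conj (b j)) hz, ← pow_mul_prod_one_sub_mul_inv a hz]
  linear_combination (γ * z ^ n) * hconj - (z ^ n * ∏ j, (z⁻¹ - conj (a j))) * hγγ

theorem exists_diskMobius_blaschkeProduct_eq (hγ : ‖γ‖ = 1) (ha : ∀ j, ‖a j‖ < 1)
    (hw : ‖w‖ < 1) : ∃ (η : ℂ) (b : Fin n → ℂ), ‖η‖ = 1 ∧ (∀ j, ‖b j‖ < 1) ∧
      ∀ z, ‖z‖ ≤ 1 → diskMobius w (blaschkeProduct γ a z) = blaschkeProduct η b z := by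
  obtain ⟨l, b, hl, hb, hnum⟩ := exists_shiftedNumerator_eq_prod hγ ha hw
  refine ⟨l / (γ * conj l), b, ?_, hb, fun z hz => ?_⟩
  · rw [norm_div, norm_mul, hγ, one_mul, Complex.norm_conj, div_self (norm_ne_zero_iff.mpr hl)]
  have hden : ∏ j, (1 - conj (a j) * z) ≠ 0 :=
    Finset.prod_ne_zero_iff.mpr fun j _ => one_sub_conj_mul_ne_zero (ha j) hz
  simp only [blaschkeProduct, Finset.prod_div_distrib, diskMobius]
  rw [← mul_div_mul_right _ _ hden, sub_mul, sub_mul, one_mul, mul_assoc (conj w),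
    mul_assoc γ, div_mul_cancel₀ _ hden, hnum, shiftedDenominator_eq_prod hγ hnum, mul_div_mul_comm]

end Postcomposition

section UnicriticalProduct

theorem criticalValues_congr {f g : ℂ → ℂ} (h : Set.EqOn f g (Metric.ball 0 1)) :
    criticalValues f = criticalValues g := by
  have hderiv z (hz : z ∈ Metric.ball (0 : ℂ) 1) : deriv f z = deriv g z :=
    (h.eventuallyEq_of_mem (Metric.isOpen_ball.mem_nhds hz)).deriv_eq
  ext w
  refine and_congr_right fun _ => exists_congr fun z => and_congr_right fun hz => ?_
  rw [hderiv z hz, h hz]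

theorem criticalValues_diskMobius_comp_subset {f : ℂ → ℂ} {w : ℂ} (hw : ‖w‖ < 1)
    (hf : Set.MapsTo f (Metric.ball 0 1) (Metric.ball 0 1))
    (hd : DifferentiableOn ℂ f (Metric.ball 0 1)) :
    criticalValues (diskMobius w ∘ f) ⊆ diskMobius w '' criticalValues f := by
  rintro _ ⟨-, z, hz, hderiv, rfl⟩
  have hfz := (mem_ball_zero_iff.mp (hf hz)).le
  rw [deriv_comp z (hasDerivAt_diskMobius (one_sub_conj_mul_ne_zero hw hfz)).differentiableAt
    (hd.differentiableAt (Metric.isOpen_ball.mem_nhds hz))] at hderiv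
  exact ⟨f z, ⟨hf hz, z, hz, (mul_eq_zero.mp hderiv).resolve_left
    (deriv_diskMobius_ne_zero hw hfz), rfl⟩, rfl⟩

variable {n : ℕ} {γ w : ℂ} {a : Fin n → ℂ}

theorem exists_diskMobius_blaschkeProduct_eq_mul_pow (hγ : ‖γ‖ = 1) (ha : ∀ j, ‖a j‖ < 1)
    (hn : n ≠ 0) (h : criticalValues (blaschkeProduct γ a) = {w}) :
    ∃ η c : ℂ, ‖η‖ = 1 ∧ ‖c‖ < 1 ∧
      ∀ z, ‖z‖ ≤ 1 → diskMobius w (blaschkeProduct γ a z) = η * diskMobius c z ^ n := by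
  have hw : ‖w‖ < 1 := mem_ball_zero_iff.mp (h.ge rfl).1
  obtain ⟨η, b, hη, hb, heq⟩ := exists_diskMobius_blaschkeProduct_eq hγ ha hw
  have hcrit : criticalValues (blaschkeProduct η b) ⊆ {0} := calc
    criticalValues (blaschkeProduct η b) = criticalValues (diskMobius w ∘ blaschkeProduct γ a) :=
      criticalValues_congr fun z hz => (heq z (mem_ball_zero_iff.mp hz).le).symm
    _ ⊆ diskMobius w '' criticalValues (blaschkeProduct γ a) :=
      criticalValues_diskMobius_comp_subset hw
        (fun z hz => mem_ball_zero_iff.mpr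
          (norm_blaschkeProduct_lt_one hn hγ ha (mem_ball_zero_iff.mp hz)))
        fun z hz => (differentiableAt_blaschkeProduct γ ha
          (mem_ball_zero_iff.mp hz).le).differentiableWithinAt
    _ = {0} := by rw [h, Set.image_singleton, diskMobius_self]
  have hconst := eq_of_criticalValues_blaschkeProduct_subset_zero hη hb hcrit
  let i : Fin n := ⟨0, Nat.pos_of_ne_zero hn⟩
  refine ⟨η, b i, hη, hb i, fun z hz => ?_⟩
  rw [heq z hz, blaschkeProduct_eq_mul_prod_diskMobius, Finset.prod_congr rfl fun j _ => by
    rw [hconst j i], Fin.prod_const]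

theorem circleFiber_eq_image_nthRoots {B : ℂ → ℂ} {η c l : ℂ} (hw : ‖w‖ < 1) (hη : ‖η‖ = 1)
    (hc : ‖c‖ < 1) (hn : n ≠ 0) (hB : ∀ z, ‖z‖ = 1 → ‖B z‖ = 1)
    (heq : ∀ z, ‖z‖ = 1 → diskMobius w (B z) = η * diskMobius c z ^ n) (hl : ‖l‖ = 1) :
    circleFiber B l = diskMobius (-c) '' {u | u ^ n = diskMobius w l / η} := by
  have hη0 : η ≠ 0 := norm_ne_zero_iff.mp (hη ▸ one_ne_zero)
  have hc' : ‖-c‖ < 1 := (norm_neg c).trans_lt hc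
  ext z
  constructor
  · rintro ⟨hz, rfl⟩
    refine ⟨diskMobius c z, ?_, diskMobius_neg_diskMobius hc hz.le⟩
    rw [Set.mem_ofPred_eq, heq z hz, mul_div_cancel_left₀ _ hη0]
  · rintro ⟨u, hul, rfl⟩
    have hu : ‖u‖ = 1 := norm_eq_one_of_pow_eq hn
      (by rw [norm_div, hη, div_one, norm_diskMobius_eq_one hw hl]) hul
    have hz := norm_diskMobius_eq_one hc' hu
    have hcu : diskMobius c (diskMobius (-c) u) = u := by
      simpa only [neg_neg] using diskMobius_neg_diskMobius hc' hu.le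
    have hwB := heq _ hz
    rw [hcu, hul, mul_div_cancel₀ _ hη0] at hwB
    refine ⟨hz, ?_⟩
    rw [← diskMobius_neg_diskMobius hw (hB _ hz).le, hwB, diskMobius_neg_diskMobius hw hl.le]

theorem exists_circleFiber_blaschkeProduct_eq_image_nthRoots (hγ : ‖γ‖ = 1) (ha : ∀ j, ‖a j‖ < 1)
    (hn : n ≠ 0) (h : criticalValues (blaschkeProduct γ a) = {w}) :
    ∃ c : ℂ, ‖c‖ < 1 ∧ ∀ l : ℂ, ‖l‖ = 1 → ∃ μ : ℂ, ‖μ‖ = 1 ∧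
      circleFiber (blaschkeProduct γ a) l = diskMobius (-c) '' {u | u ^ n = μ} := by
  have hw : ‖w‖ < 1 := mem_ball_zero_iff.mp (h.ge rfl).1
  obtain ⟨η, c, hη, hc, heq⟩ := exists_diskMobius_blaschkeProduct_eq_mul_pow hγ ha hn h
  refine ⟨c, hc, fun l hl => ⟨diskMobius w l / η, ?_, circleFiber_eq_image_nthRoots hw hη hc hn
    (fun z hz => norm_blaschkeProduct_eq_one hγ ha hz) (fun z hz => heq z hz.le) hl⟩⟩
  rw [norm_div, hη, div_one, norm_diskMobius_eq_one hw hl]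

end UnicriticalProduct

section KleinMap

/-- The denominator of `kleinMap c`, an affine function. -/
noncomputable def kleinDenom (c : ℂ) : ℂ →ᵃ[ℝ] ℝ :=
  ((-2 : ℝ) • innerₛₗ ℝ c).toAffineMap + AffineMap.const ℝ ℂ (1 + ‖c‖ ^ 2)

/-- The numerator of `kleinMap c`, an affine map. -/
noncomputable def kleinNum (c : ℂ) : ℂ →ᵃ[ℝ] ℂ :=
  (LinearMap.id + c ^ 2 • Complex.conjAe.toLinearMap).toAffineMap + AffineMap.const ℝ ℂ (-2 * c)

/-- The projective map that preserves the unit disk and agrees with `diskMobius c` on its boundary: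
the isometry of the Klein model of the hyperbolic plane that takes straight chords to chords. -/
noncomputable def kleinMap (c z : ℂ) : ℂ := (kleinDenom c z)⁻¹ • kleinNum c z

variable {c z w v : ℂ}

theorem kleinDenom_apply (c z : ℂ) : kleinDenom c z = 1 + ‖c‖ ^ 2 - 2 * inner ℝ c z := by
  simp only [kleinDenom, neg_smul, AffineMap.coe_add, LinearMap.coe_toAffineMap, LinearMap.coe_neg,
    LinearMap.coe_smul, coe_innerₛₗ_apply, Complex.inner, Complex.mul_re, Complex.conj_re,
    Complex.conj_im, mul_neg, sub_neg_eq_add, AffineMap.coe_const, Pi.add_apply, Pi.neg_apply,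
    Pi.smul_apply, smul_eq_mul, Function.const_apply]
  ring

theorem kleinNum_apply (c z : ℂ) : kleinNum c z = z - 2 * c + c ^ 2 * conj z := by
  simp only [kleinNum, neg_mul, AffineMap.coe_add, LinearMap.coe_toAffineMap, AffineMap.coe_const,
    Pi.add_apply, LinearMap.add_apply, LinearMap.id_coe, id_eq, LinearMap.smul_apply,
    AlgEquiv.toLinearMap_apply, Complex.conjAe_coe, smul_eq_mul, Function.const_apply]
  ring

theorem inner_eq_re_mul_re_add_im_mul_im (z w : ℂ) :
    inner ℝ z w = z.re * w.re + z.im * w.im := by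
  rw [Complex.inner, Complex.mul_re, Complex.conj_re, Complex.conj_im]
  ring

theorem kleinDenom_eq_re_im (c z : ℂ) :
    kleinDenom c z = 1 + (c.re ^ 2 + c.im ^ 2) - 2 * (c.re * z.re + c.im * z.im) := by
  rw [kleinDenom_apply, inner_eq_re_mul_re_add_im_mul_im, Complex.sq_norm, Complex.normSq_apply]
  ring

theorem kleinNum_re (c z : ℂ) : (kleinNum c z).re =
    z.re - 2 * c.re + (c.re ^ 2 - c.im ^ 2) * z.re + 2 * c.re * c.im * z.im := by
  simp only [kleinNum_apply, pow_two, Complex.add_re, Complex.sub_re, Complex.mul_re,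
    Complex.re_ofNat, Complex.im_ofNat, zero_mul, sub_zero, Complex.conj_re, Complex.mul_im,
    Complex.conj_im, mul_neg, sub_neg_eq_add]
  ring

theorem kleinNum_im (c z : ℂ) : (kleinNum c z).im =
    z.im - 2 * c.im + 2 * c.re * c.im * z.re - (c.re ^ 2 - c.im ^ 2) * z.im := by
  simp only [kleinNum_apply, pow_two, Complex.add_im, Complex.sub_im, Complex.mul_im,
    Complex.re_ofNat, Complex.im_ofNat, zero_mul, add_zero, Complex.mul_re, Complex.conj_im,
    mul_neg, Complex.conj_re]
  ring

theorem kleinDenom_pos (hc : ‖c‖ < 1) (hz : ‖z‖ ≤ 1) : 0 < kleinDenom c z := by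
  have hinner : inner ℝ c z ≤ ‖c‖ * 1 := (real_inner_le_norm c z).trans (by gcongr)
  rw [kleinDenom_apply]
  nlinarith [sq_pos_of_pos (sub_pos.mpr hc)]

theorem kleinDenom_of_norm_eq_one (c : ℂ) (hz : ‖z‖ = 1) :
    kleinDenom c z = ‖1 - conj c * z‖ ^ 2 := by
  rw [Complex.sq_norm, Complex.normSq_sub, Complex.normSq_mul, Complex.normSq_eq_norm_sq z, hz,
    kleinDenom_apply, Complex.inner, Complex.normSq_conj]
  simp [mul_comm, Complex.sq_norm]

theorem kleinMap_of_norm_eq_one (hc : ‖c‖ < 1) (hz : ‖z‖ = 1) :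
    kleinMap c z = diskMobius c z := by
  have hden := one_sub_conj_mul_ne_zero hc hz.le
  have hden' : conj (1 - conj c * z) ≠ 0 := (map_ne_zero _).mpr hden
  have hzz : conj z * z = 1 := by rw [Complex.conj_mul', hz]; norm_num
  rw [kleinMap, kleinDenom_of_norm_eq_one c hz, Complex.real_smul, Complex.ofReal_inv,
    Complex.ofReal_pow, ← Complex.mul_conj', kleinNum_apply, diskMobius]
  field_simp
  simp only [map_sub, map_mul, map_one, Complex.conj_conj]
  linear_combination c * hzz

theorem kleinDenom_mul_sub_inner_kleinNum (c z w : ℂ) :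
    kleinDenom c z * kleinDenom c w - inner ℝ (kleinNum c z) (kleinNum c w) =
      (1 - ‖c‖ ^ 2) ^ 2 * (1 - inner ℝ z w) := by
  simp only [inner_eq_re_mul_re_add_im_mul_im, kleinDenom_eq_re_im, kleinNum_re, kleinNum_im,
    Complex.sq_norm, Complex.normSq_apply]
  ring

theorem kleinDenom_sq_sub_norm_kleinNum_sq (c z : ℂ) :
    kleinDenom c z ^ 2 - ‖kleinNum c z‖ ^ 2 = (1 - ‖c‖ ^ 2) ^ 2 * (1 - ‖z‖ ^ 2) := by
  rw [← real_inner_self_eq_norm_sq, ← real_inner_self_eq_norm_sq z, pow_two (kleinDenom c z),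
    kleinDenom_mul_sub_inner_kleinNum]

theorem kleinMap_neg_kleinMap (hc : ‖c‖ < 1) (hz : ‖z‖ ≤ 1) :
    kleinMap (-c) (kleinMap c z) = z := by
  have hL := (kleinDenom_pos hc hz).ne'
  have hκ : (1 - ‖c‖ ^ 2) ^ 2 ≠ 0 := pow_ne_zero 2 (one_sub_norm_sq_pos hc).ne'
  have hden : kleinDenom (-c) (kleinMap c z) = (kleinDenom c z)⁻¹ * (1 - ‖c‖ ^ 2) ^ 2 := by
    rw [eq_inv_mul_iff_mul_eq₀ hL, kleinMap, kleinDenom_apply (-c), real_inner_smul_right, norm_neg,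
      mul_sub, mul_left_comm 2, mul_inv_cancel_left₀ hL]
    simp only [inner_eq_re_mul_re_add_im_mul_im, kleinDenom_eq_re_im, kleinNum_re, kleinNum_im,
      Complex.sq_norm, Complex.normSq_apply, Complex.neg_re, Complex.neg_im]
    ring
  have hnum : kleinNum (-c) (kleinMap c z) = ((kleinDenom c z)⁻¹ * (1 - ‖c‖ ^ 2) ^ 2) • z := by
    apply Complex.ext
    all_goals
      simp only [kleinNum_re (-c), kleinNum_im (-c), kleinMap, Complex.smul_re, Complex.smul_im,
        smul_eq_mul, Complex.neg_re, Complex.neg_im]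
      field_simp
      simp only [kleinDenom_eq_re_im, kleinNum_re, kleinNum_im, Complex.sq_norm,
        Complex.normSq_apply]
      ring
  rw [kleinMap, hden, hnum, inv_smul_smul₀ (mul_ne_zero (inv_ne_zero hL) hκ)]

theorem kleinMap_eq_kleinMap_iff (hc : ‖c‖ < 1) (hz : ‖z‖ ≤ 1) (hw : ‖w‖ ≤ 1) :
    kleinMap c z = kleinMap c w ↔ z = w :=
  ⟨fun h => by rw [← kleinMap_neg_kleinMap hc hz, h, kleinMap_neg_kleinMap hc hw],
    congrArg (kleinMap c)⟩

theorem orient_inv_smul {r s t : ℝ} (hr : r ≠ 0) (hs : s ≠ 0) (ht : t ≠ 0) (z w v : ℂ) :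
    r * s * t * orient (r⁻¹ • z) (s⁻¹ • w) (t⁻¹ • v) =
      r * (conj w * v).im + s * (conj v * z).im + t * (conj z * w).im := by
  simp only [orient, Complex.mul_im, Complex.conj_re, Complex.conj_im, Complex.sub_re,
    Complex.sub_im, Complex.smul_re, Complex.smul_im, smul_eq_mul]
  field_simp
  ring

theorem orient_kleinMap (hz : kleinDenom c z ≠ 0) (hw : kleinDenom c w ≠ 0)
    (hv : kleinDenom c v ≠ 0) :
    kleinDenom c z * kleinDenom c w * kleinDenom c v *
        orient (kleinMap c z) (kleinMap c w) (kleinMap c v) =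
      (1 - ‖c‖ ^ 2) ^ 3 * orient z w v := by
  rw [kleinMap, kleinMap, kleinMap, orient_inv_smul hz hw hv]
  simp only [orient, kleinDenom_eq_re_im, kleinNum_re, kleinNum_im, Complex.sq_norm,
    Complex.normSq_apply, Complex.mul_im, Complex.conj_re, Complex.conj_im, Complex.sub_re,
    Complex.sub_im]
  ring

theorem orient_kleinMap_nonneg_iff (hc : ‖c‖ < 1) (hz : ‖z‖ ≤ 1) (hw : ‖w‖ ≤ 1) (hv : ‖v‖ ≤ 1) :
    0 ≤ orient (kleinMap c z) (kleinMap c w) (kleinMap c v) ↔ 0 ≤ orient z w v := by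
  have hLz := kleinDenom_pos hc hz
  have hLw := kleinDenom_pos hc hw
  have hLv := kleinDenom_pos hc hv
  rw [← mul_nonneg_iff_of_pos_left (mul_pos (mul_pos hLz hLw) hLv),
    orient_kleinMap hLz.ne' hLw.ne' hLv.ne',
    mul_nonneg_iff_of_pos_left (pow_pos (one_sub_norm_sq_pos hc) 3)]

theorem isPolygonSide_kleinMap_iff (hc : ‖c‖ < 1) {V : Set ℂ} (hV : ∀ u ∈ V, ‖u‖ ≤ 1)
    (hz : z ∈ V) (hw : w ∈ V) :
    IsPolygonSide (kleinMap c '' V) (kleinMap c z) (kleinMap c w) ↔ IsPolygonSide V z w := by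
  simp only [IsPolygonSide, Set.mem_image_of_mem _ hz, Set.mem_image_of_mem _ hw, hz, hw,
    true_and, ne_eq, kleinMap_eq_kleinMap_iff hc (hV z hz) (hV w hw), Set.forall_mem_image]
  exact and_congr_right fun _ => forall₂_congr fun v hv =>
    orient_kleinMap_nonneg_iff hc (hV z hz) (hV w hw) (hV v hv)

theorem kleinMap_mem_convexHull_image (hc : ‖c‖ < 1) {V : Set ℂ} (hV : ∀ u ∈ V, ‖u‖ ≤ 1)
    (hz : z ∈ convexHull ℝ V) : kleinMap c z ∈ convexHull ℝ (kleinMap c '' V) :=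
  inv_smul_mem_convexHull_image (kleinNum c) (kleinDenom c)
    (fun u hu => kleinDenom_pos hc (hV u hu)) hz

end KleinMap

section Conic

/-- The quadratic function whose zero set in the unit disk is the preimage under `kleinMap c` of
the circle of radius `√(1 - δ)` about `0`. -/
noncomputable def conicForm (δ : ℝ) (c z : ℂ) : ℝ :=
  δ * kleinDenom c z ^ 2 - (1 - ‖c‖ ^ 2) ^ 2 * (1 - ‖z‖ ^ 2)

variable {δ : ℝ} {c z w : ℂ}

theorem conicForm_eq_zero_iff (hc : ‖c‖ < 1) (hz : ‖z‖ ≤ 1) :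
    conicForm δ c z = 0 ↔ ‖kleinMap c z‖ ^ 2 = 1 - δ := by
  have hL := kleinDenom_pos hc hz
  rw [conicForm, ← kleinDenom_sq_sub_norm_kleinNum_sq, kleinMap, norm_smul, mul_pow, norm_inv,
    Real.norm_of_nonneg hL.le, inv_pow, inv_mul_eq_iff_eq_mul₀ (pow_ne_zero 2 hL.ne')]
  constructor <;> intro h <;> linear_combination h

theorem norm_lt_one_of_conicForm_nonpos (hδ : 0 < δ) (hc : ‖c‖ < 1) (h : conicForm δ c z ≤ 0) :
    ‖z‖ < 1 := by
  have hκ : 0 < (1 - ‖c‖ ^ 2) ^ 2 := pow_pos (one_sub_norm_sq_pos hc) 2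
  have hle : δ * kleinDenom c z ^ 2 ≤ (1 - ‖c‖ ^ 2) ^ 2 * (1 - ‖z‖ ^ 2) := sub_nonpos.mp h
  have hz : ‖z‖ ≤ 1 := (sq_le_one_iff₀ (norm_nonneg z)).mp <| sub_nonneg.mp <|
    nonneg_of_mul_nonneg_right ((by positivity : 0 ≤ δ * kleinDenom c z ^ 2).trans hle) hκ
  refine hz.lt_of_ne fun heq => ?_
  rw [heq, one_pow, sub_self, mul_zero] at hle
  exact hle.not_gt (mul_pos hδ (pow_pos (kleinDenom_pos hc hz) 2))

theorem continuous_kleinDenom (c : ℂ) : Continuous (kleinDenom c) :=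
  (kleinDenom c).continuous_of_finiteDimensional

theorem continuous_conicForm (δ : ℝ) (c : ℂ) : Continuous (conicForm δ c) := by
  have := continuous_kleinDenom c
  unfold conicForm
  fun_prop

theorem differentiableAt_conicForm (δ : ℝ) (c z : ℂ) : DifferentiableAt ℝ (conicForm δ c) z := by
  have hL : DifferentiableAt ℝ (kleinDenom c) z :=
    (⟨kleinDenom c, continuous_kleinDenom c⟩ : ℂ →ᴬ[ℝ] ℝ).differentiable z
  unfold conicForm
  exact ((hL.pow 2).const_mul δ).sub ((differentiableAt_id.norm_sq ℝ).const_sub 1 |>.const_mul _)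

theorem strictConvexOn_conicForm (hδ : 0 ≤ δ) (hc : ‖c‖ < 1) :
    StrictConvexOn ℝ Set.univ (conicForm δ c) := by
  have hκ : 0 < (1 - ‖c‖ ^ 2) ^ 2 := pow_pos (one_sub_norm_sq_pos hc) 2
  have hsq : ConvexOn ℝ Set.univ fun z => kleinDenom c z ^ 2 :=
    (even_two.convexOn_pow (𝕜 := ℝ)).comp_affineMap (kleinDenom c)
  have hstrong : StrongConvexOn Set.univ (2 * (1 - ‖c‖ ^ 2) ^ 2) (conicForm δ c) := by
    refine strongConvexOn_iff_convex.mpr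
      (((hsq.smul hδ).add_const (-(1 - ‖c‖ ^ 2) ^ 2)).congr fun z _ => ?_)
    simp only [conicForm, smul_eq_mul, Pi.add_apply]
    ring
  exact hstrong.strictConvexOn (by positivity)

theorem isCompact_conicForm_nonpos (hδ : 0 < δ) (hc : ‖c‖ < 1) :
    IsCompact {z | conicForm δ c z ≤ 0} :=
  (isCompact_closedBall (0 : ℂ) 1).of_isClosed_subset
    (isClosed_le (continuous_conicForm δ c) continuous_const) fun _ hz =>
      mem_closedBall_zero_iff.mpr (norm_lt_one_of_conicForm_nonpos hδ hc hz).le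

theorem conicForm_lineMap (hz : ‖z‖ = 1) (hw : ‖w‖ = 1) (hc : ‖c‖ < 1)
    (h : inner ℝ (kleinMap c z) (kleinMap c w) = 1 - 2 * δ) (x : ℝ) :
    conicForm δ c (AffineMap.lineMap z w x) =
      δ * ((1 - x) * kleinDenom c z - x * kleinDenom c w) ^ 2 := by
  have hLz := (kleinDenom_pos hc hz.le).ne'
  have hLw := (kleinDenom_pos hc hw.le).ne'
  have hden : kleinDenom c (AffineMap.lineMap z w x) =
      (1 - x) * kleinDenom c z + x * kleinDenom c w := by
    rw [AffineMap.apply_lineMap, AffineMap.lineMap_apply_module, smul_eq_mul, smul_eq_mul]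
  have hnorm : ‖AffineMap.lineMap z w x‖ ^ 2 = 1 - 2 * x * (1 - x) * (1 - inner ℝ z w) := by
    rw [AffineMap.lineMap_apply_module, norm_add_sq_real, norm_smul, norm_smul, hz, hw,
      real_inner_smul_left, real_inner_smul_right, mul_one, mul_one, Real.norm_eq_abs,
      Real.norm_eq_abs, sq_abs, sq_abs]
    ring
  have hpolar : 2 * δ * (kleinDenom c z * kleinDenom c w) =
      (1 - ‖c‖ ^ 2) ^ 2 * (1 - inner ℝ z w) := by
    rw [kleinMap, kleinMap, real_inner_smul_left, real_inner_smul_right] at h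
    rw [← kleinDenom_mul_sub_inner_kleinNum]
    field_simp at h
    linear_combination h
  rw [conicForm, hden, hnorm]
  linear_combination (2 * x * (1 - x)) * hpolar

theorem exists_segmentTangentAt_conic (hδ : 0 ≤ δ) (hc : ‖c‖ < 1) (hz : ‖z‖ = 1) (hw : ‖w‖ = 1)
    (hzw : z ≠ w) (h : inner ℝ (kleinMap c z) (kleinMap c w) = 1 - 2 * δ) :
    ∃ p, SegmentTangentAt {v | conicForm δ c v = 0} z w p := by
  have hLz := kleinDenom_pos hc hz.le
  have hLw := kleinDenom_pos hc hw.le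
  let x := kleinDenom c z / (kleinDenom c z + kleinDenom c w)
  have hx : x ∈ Set.Ioo (0 : ℝ) 1 :=
    ⟨by positivity, (div_lt_one (by positivity)).mpr (lt_add_of_pos_right _ hLw)⟩
  have hzero : conicForm δ c (AffineMap.lineMap z w x) = 0 := by
    rw [conicForm_lineMap hz hw hc h]
    have : (1 - x) * kleinDenom c z - x * kleinDenom c w = 0 := by
      simp only [x]
      field_simp
      ring
    rw [this, zero_pow two_ne_zero, mul_zero]
  have hmin : IsMinOn (conicForm δ c) (segment ℝ z w) (AffineMap.lineMap z w x) := by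
    rw [segment_eq_image_lineMap]
    rintro _ ⟨y, -, rfl⟩
    rw [Set.mem_ofPred_eq, hzero, conicForm_lineMap hz hw hc h]
    positivity
  refine ⟨_, hzero ▸ segmentTangentAt_level (strictConvexOn_conicForm hδ hc)
    (differentiableAt_conicForm δ c _) hzw ?_ hmin⟩
  exact openSegment_eq_image_lineMap ℝ z w ▸ Set.mem_image_of_mem _ hx

/-- The coefficient of `‖u‖ ^ 2` in `conicForm δ c (conicCenter δ c + u)`. -/
noncomputable def conicScale (δ : ℝ) (c : ℂ) : ℝ := (1 - ‖c‖ ^ 2) ^ 2 + 4 * δ * ‖c‖ ^ 2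

/-- The center of the conic `conicForm δ c = 0`, that is, the critical point of its equation. -/
noncomputable def conicCenter (δ : ℝ) (c : ℂ) : ℂ := (2 * δ * (1 + ‖c‖ ^ 2) / conicScale δ c) • c

theorem conicScale_pos (hδ : 0 ≤ δ) (hc : ‖c‖ < 1) : 0 < conicScale δ c :=
  add_pos_of_pos_of_nonneg (pow_pos (one_sub_norm_sq_pos hc) 2) (by positivity)

theorem inner_sq_add_inner_I_mul_sq (c u : ℂ) :
    inner ℝ c u ^ 2 + inner ℝ (Complex.I * c) u ^ 2 = ‖c‖ ^ 2 * ‖u‖ ^ 2 := by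
  simp only [inner_eq_re_mul_re_add_im_mul_im, Complex.I_mul_re, Complex.I_mul_im, Complex.sq_norm,
    Complex.normSq_apply]
  ring

theorem conicForm_conicCenter_add (hδ : 0 ≤ δ) (hc : ‖c‖ < 1) (u : ℂ) :
    conicForm δ c (conicCenter δ c + u) =
      conicScale δ c * ‖u‖ ^ 2 - 4 * δ * inner ℝ (Complex.I * c) u ^ 2 -
        (1 - δ) * (1 - ‖c‖ ^ 2) ^ 4 / conicScale δ c := by
  have hE := (conicScale_pos hδ hc).ne'
  obtain ⟨m, hm⟩ : ∃ m, m = 2 * δ * (1 + ‖c‖ ^ 2) / conicScale δ c := ⟨_, rfl⟩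
  have hmE : m * conicScale δ c = 2 * δ * (1 + ‖c‖ ^ 2) := by rw [hm, div_mul_cancel₀ _ hE]
  have hconst : (1 - δ) * (1 - ‖c‖ ^ 2) ^ 4 / conicScale δ c =
      (1 - ‖c‖ ^ 2) ^ 2 + 2 * δ * (1 + ‖c‖ ^ 2) * m * ‖c‖ ^ 2 - δ * (1 + ‖c‖ ^ 2) ^ 2 := by
    rw [div_eq_iff hE]
    rw [conicScale] at hmE ⊢
    linear_combination -2 * δ * (1 + ‖c‖ ^ 2) * ‖c‖ ^ 2 * hmE
  rw [hconst, conicForm, kleinDenom_apply, conicCenter, ← hm, inner_add_right, norm_add_sq_real,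
    real_inner_smul_left, real_inner_smul_right, real_inner_self_eq_norm_sq, norm_smul, mul_pow,
    Real.norm_eq_abs, sq_abs]
  rw [conicScale] at hmE ⊢
  linear_combination
    (m * ‖c‖ ^ 2 + 2 * inner ℝ c u) * hmE + 4 * δ * inner_sq_add_inner_I_mul_sq c u

theorem conicForm_conicCenter_nonpos (hδ : 0 ≤ δ) (hδ₁ : δ ≤ 1) (hc : ‖c‖ < 1) :
    conicForm δ c (conicCenter δ c) ≤ 0 := by
  have h := conicForm_conicCenter_add hδ hc 0
  have hE := conicScale_pos hδ hc
  have hδ' := sub_nonneg.mpr hδ₁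
  rw [add_zero, norm_zero, inner_zero_right] at h
  rw [h]
  have : 0 ≤ (1 - δ) * (1 - ‖c‖ ^ 2) ^ 4 / conicScale δ c := by positivity
  linarith

theorem conicForm_one_eq_zero_iff (hc : ‖c‖ < 1) :
    conicForm 1 c z = 0 ↔ z = conicCenter 1 c := by
  obtain ⟨u, rfl⟩ : ∃ u, z = conicCenter 1 c + u := ⟨z - conicCenter 1 c, by ring⟩
  have hκ : 0 < (1 - ‖c‖ ^ 2) ^ 2 := pow_pos (one_sub_norm_sq_pos hc) 2
  rw [conicForm_conicCenter_add zero_le_one hc, add_eq_left, conicScale]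
  constructor
  · intro h
    have hle : (1 - ‖c‖ ^ 2) ^ 2 * ‖u‖ ^ 2 ≤ 0 := by
      have hneg : (1 - ‖c‖ ^ 2) ^ 2 * ‖u‖ ^ 2 = -(4 * inner ℝ c u ^ 2) := by
        linear_combination h + 4 * inner_sq_add_inner_I_mul_sq c u
      exact hneg ▸ neg_nonpos.mpr (by positivity)
    exact norm_eq_zero.mp (pow_eq_zero_iff two_ne_zero |>.mp
      ((nonpos_of_mul_nonpos_right hle hκ).antisymm (sq_nonneg _)))
  · rintro rfl
    simp

end Conic

section Ellipse

theorem add_eq_two_mul_iff_of_abs_sub_lt {A B a : ℝ} (hA : 0 ≤ A) (hB : 0 ≤ B)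
    (h : |A - B| < 2 * a) :
    A + B = 2 * a ↔ 16 * a ^ 4 - 8 * (A ^ 2 + B ^ 2) * a ^ 2 + (A ^ 2 - B ^ 2) ^ 2 = 0 := by
  have ha : 0 < 2 * a := (abs_nonneg _).trans_lt h
  have hsq : (A - B) ^ 2 < (2 * a) ^ 2 := sq_lt_sq.mpr (by rwa [abs_of_pos ha])
  have hfactor : 16 * a ^ 4 - 8 * (A ^ 2 + B ^ 2) * a ^ 2 + (A ^ 2 - B ^ 2) ^ 2 =
      (2 * a - (A + B)) * ((2 * a + (A + B)) * ((2 * a) ^ 2 - (A - B) ^ 2)) := by ring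
  have hpos : 0 < (2 * a + (A + B)) * ((2 * a) ^ 2 - (A - B) ^ 2) :=
    mul_pos (by linarith) (sub_pos.mpr hsq)
  rw [hfactor, mul_eq_zero, or_iff_left hpos.ne', sub_eq_zero, eq_comm]

theorem norm_sub_add_norm_add_eq_iff {E : Type*} [NormedAddCommGroup E] [InnerProductSpace ℝ E]
    {e : E} {a : ℝ} (he : ‖e‖ < a) (u : E) :
    ‖u - e‖ + ‖u + e‖ = 2 * a ↔
      a ^ 2 * ‖u‖ ^ 2 - inner ℝ e u ^ 2 = a ^ 2 * (a ^ 2 - ‖e‖ ^ 2) := by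
  have habs : |‖u - e‖ - ‖u + e‖| < 2 * a := calc
    |‖u - e‖ - ‖u + e‖| ≤ ‖(u - e) - (u + e)‖ := abs_norm_sub_norm_le _ _
    _ = ‖(-2 : ℝ) • e‖ := by congr 1; module
    _ = 2 * ‖e‖ := by rw [norm_smul]; norm_num
    _ < 2 * a := by gcongr
  rw [add_eq_two_mul_iff_of_abs_sub_lt (norm_nonneg _) (norm_nonneg _) habs, norm_sub_sq_real,
    norm_add_sq_real, real_inner_comm]
  constructor <;> intro h <;> nlinarith [h]

theorem isEllipse_quadric (m : ℂ) {e : ℂ} {a : ℝ} (he : ‖e‖ < a) :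
    IsEllipse {z | a ^ 2 * ‖z - m‖ ^ 2 - inner ℝ e (z - m) ^ 2 = a ^ 2 * (a ^ 2 - ‖e‖ ^ 2)} := by
  refine ⟨m + e, m - e, 2 * a, ?_, Set.ext fun z => ?_⟩
  · calc dist (m + e) (m - e) = ‖(2 : ℝ) • e‖ := by rw [dist_eq_norm]; congr 1; module
      _ = 2 * ‖e‖ := by rw [norm_smul, Real.norm_two]
      _ < 2 * a := by gcongr
  · rw [Set.mem_ofPred_eq, Set.mem_ofPred_eq, ← norm_sub_add_norm_add_eq_iff he, dist_eq_norm,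
      dist_eq_norm, sub_add_eq_sub_sub, sub_sub_eq_add_sub, add_sub_right_comm]

theorem isEllipse_conic {δ : ℝ} {c : ℂ} (hδ : 0 ≤ δ) (hδ₁ : δ < 1) (hc : ‖c‖ < 1) :
    IsEllipse {z | conicForm δ c z = 0} := by
  have hE := conicScale_pos hδ hc
  have hκ := one_sub_norm_sq_pos hc
  have hδ' := sub_pos.mpr hδ₁
  obtain ⟨a, ha, ha2⟩ : ∃ a > 0, a ^ 2 = (1 - δ) * (1 - ‖c‖ ^ 2) ^ 2 / conicScale δ c :=
    ⟨√_, Real.sqrt_pos.mpr (by positivity), Real.sq_sqrt (by positivity)⟩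
  obtain ⟨k, hk2⟩ : ∃ k, k ^ 2 = 4 * δ / conicScale δ c * a ^ 2 :=
    ⟨√_, Real.sq_sqrt (by positivity)⟩
  have he2 : a ^ 2 - ‖k • (Complex.I * c)‖ ^ 2 = a ^ 2 * ((1 - ‖c‖ ^ 2) ^ 2 / conicScale δ c) := by
    rw [norm_smul, norm_mul, Complex.norm_I, one_mul, mul_pow, Real.norm_eq_abs, sq_abs, hk2]
    field_simp
    rw [conicScale]
    ring
  have he : ‖k • (Complex.I * c)‖ < a :=
    lt_of_pow_lt_pow_left₀ 2 ha.le (sub_pos.mp (he2 ▸ by positivity))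
  convert isEllipse_quadric (conicCenter δ c) he using 3 with z
  have h := conicForm_conicCenter_add hδ hc (z - conicCenter δ c)
  have hscaled : conicForm δ c z * (a ^ 2 / conicScale δ c) =
      a ^ 2 * ‖z - conicCenter δ c‖ ^ 2 - (k * inner ℝ (Complex.I * c) (z - conicCenter δ c)) ^ 2 -
        a ^ 2 * (a ^ 2 * ((1 - ‖c‖ ^ 2) ^ 2 / conicScale δ c)) := by
    rw [add_sub_cancel] at h
    rw [h, mul_pow, hk2, ha2]
    field_simp
  rw [he2, real_inner_smul_left, ← sub_eq_zero (b := a ^ 2 * _), ← hscaled,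
    mul_eq_zero_iff_right (by positivity)]

end Ellipse

section BlaschkeCurve

variable {n : ℕ} {c p z w μ : ℂ}

theorem image_diskMobius_nthRoots (hn : n ≠ 0) (hc : ‖c‖ < 1) (hμ : ‖μ‖ = 1) :
    diskMobius c '' {u | u ^ n = μ} = kleinMap c '' {u | u ^ n = μ} :=
  Set.image_congr fun _ hu => (kleinMap_of_norm_eq_one hc (norm_eq_one_of_pow_eq hn hμ hu)).symm

theorem isPolygonSide_kleinMap_nthRoots_iff (hn : 2 ≤ n) (hc : ‖c‖ < 1) (hμ : ‖μ‖ = 1) :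
    IsPolygonSide (kleinMap c '' {u | u ^ n = μ}) z w ↔
      ∃ u, u ^ n = μ ∧ kleinMap c u = z ∧ kleinMap c (u * primRoot n) = w := by
  have hV : ∀ u ∈ {u : ℂ | u ^ n = μ}, ‖u‖ ≤ 1 :=
    fun u hu => (norm_eq_one_of_pow_eq (by omega) hμ hu).le
  constructor
  · intro h
    obtain ⟨⟨u, hu, rfl⟩, ⟨v, hv, rfl⟩, -⟩ := id h
    obtain ⟨-, rfl⟩ := (isPolygonSide_nthRoots_iff hn hμ).mp
      ((isPolygonSide_kleinMap_iff hc hV hu hv).mp h)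
    exact ⟨u, hu, rfl, rfl⟩
  · rintro ⟨u, hu, rfl, rfl⟩
    have hside := (isPolygonSide_nthRoots_iff hn hμ).mpr ⟨hu, rfl⟩
    exact (isPolygonSide_kleinMap_iff hc hV hu hside.2.1).mpr hside

/-- The Blaschke curve of a Blaschke product whose circle fibers are the images under
`kleinMap (-c)` of the regular `n`-gons inscribed in the unit circle: the preimage under
`kleinMap c` of the common incircle of these `n`-gons, of radius `cos (π / n)`. -/
noncomputable def inscribedConic (n : ℕ) (c : ℂ) : Set ℂ :=
  {z | conicForm (sin (π / n) ^ 2) c z = 0}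

theorem sin_pi_div_sq_pos (hn : 2 ≤ n) : 0 < sin (π / n) ^ 2 := by
  have h := sin_nat_mul_pi_div_pos one_pos (show 1 < n by omega)
  rw [Nat.cast_one, one_mul] at h
  positivity

theorem cos_pi_div_nonneg (hn : 2 ≤ n) : 0 ≤ cos (π / n) :=
  cos_nonneg_of_neg_pi_div_two_le_of_le
    ((neg_nonpos.mpr pi_div_two_pos.le).trans (by positivity)) (by gcongr; exact_mod_cast hn)

theorem norm_lt_one_of_mem_inscribedConic (hn : 2 ≤ n) (hc : ‖c‖ < 1)
    (hp : p ∈ inscribedConic n c) : ‖p‖ < 1 :=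
  norm_lt_one_of_conicForm_nonpos (sin_pi_div_sq_pos hn) hc (le_of_eq hp)

theorem norm_kleinMap_of_mem_inscribedConic (hn : 2 ≤ n) (hc : ‖c‖ < 1)
    (hp : p ∈ inscribedConic n c) : ‖kleinMap c p‖ = cos (π / n) := by
  have hz := (norm_lt_one_of_mem_inscribedConic hn hc hp).le
  rw [← pow_left_inj₀ (norm_nonneg _) (cos_pi_div_nonneg hn) two_ne_zero, cos_sq',
    (conicForm_eq_zero_iff hc hz).mp hp]

theorem exists_convex_frontier_eq_inscribedConic (hn : 2 ≤ n) (hc : ‖c‖ < 1) :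
    ∃ K : Set ℂ, K.Nonempty ∧ IsCompact K ∧ Convex ℝ K ∧ inscribedConic n c = frontier K := by
  have hδ := sin_pi_div_sq_pos hn
  have hconvex := strictConvexOn_conicForm hδ.le hc
  have hsublevel : Convex ℝ {z | conicForm (sin (π / n) ^ 2) c z ≤ 0} := by
    simpa only [Set.mem_univ, true_and] using hconvex.convexOn.convex_le 0
  have hcenter := conicForm_conicCenter_nonpos hδ.le (sin_sq_le_one _) hc
  exact ⟨_, ⟨_, hcenter⟩, isCompact_conicForm_nonpos hδ hc, hsublevel,
    (frontier_sublevel_eq_level hconvex (continuous_conicForm _ c) 0).symm⟩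

theorem inscribedConic_two (hc : ‖c‖ < 1) : inscribedConic 2 c = {conicCenter 1 c} := by
  ext z
  rw [inscribedConic, Nat.cast_two, sin_pi_div_two, one_pow]
  exact conicForm_one_eq_zero_iff hc

theorem isEllipse_inscribedConic (hn : 3 ≤ n) (hc : ‖c‖ < 1) : IsEllipse (inscribedConic n c) := by
  have hcos : 0 < cos (π / n) := cos_pos_of_mem_Ioo
    ⟨(neg_lt_zero.mpr pi_div_two_pos).trans_le (by positivity), by gcongr; exact_mod_cast hn⟩
  refine isEllipse_conic (sq_nonneg _) ?_ hc
  rw [sin_sq, sub_lt_self_iff]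
  positivity

theorem inscribedConic_subset_convexHull (hn : 2 ≤ n) (hc : ‖c‖ < 1) (hμ : ‖μ‖ = 1) :
    inscribedConic n c ⊆ convexHull ℝ (kleinMap (-c) '' {u | u ^ n = μ}) := by
  intro p hp
  have hn₀ : n ≠ 0 := by omega
  rw [← kleinMap_neg_kleinMap hc (norm_lt_one_of_mem_inscribedConic hn hc hp).le]
  exact kleinMap_mem_convexHull_image ((norm_neg c).trans_lt hc)
    (fun u hu => (norm_eq_one_of_pow_eq hn₀ hμ hu).le)
    (mem_convexHull_nthRoots hn₀ hμ (norm_kleinMap_of_mem_inscribedConic hn hc hp).le)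

theorem exists_segmentTangentAt_inscribedConic (hn : 2 ≤ n) (hc : ‖c‖ < 1) (hμ : ‖μ‖ = 1)
    (h : IsPolygonSide (kleinMap (-c) '' {u | u ^ n = μ}) z w) :
    ∃ p, SegmentTangentAt (inscribedConic n c) z w p := by
  have hc' := (norm_neg c).trans_lt hc
  obtain ⟨u, hu, rfl, rfl⟩ := (isPolygonSide_kleinMap_nthRoots_iff hn hc' hμ).mp h
  have hu₁ : ‖u‖ = 1 := norm_eq_one_of_pow_eq (by omega) hμ hu
  have hv₁ : ‖u * primRoot n‖ = 1 := by rw [norm_mul, hu₁, norm_primRoot, one_mul]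
  have hnorm {v : ℂ} (hv : ‖v‖ = 1) : ‖kleinMap (-c) v‖ = 1 :=
    kleinMap_of_norm_eq_one hc' hv ▸ norm_diskMobius_eq_one hc' hv
  have hinv {v : ℂ} (hv : ‖v‖ = 1) : kleinMap c (kleinMap (-c) v) = v := by
    simpa only [neg_neg] using kleinMap_neg_kleinMap hc' hv.le
  refine exists_segmentTangentAt_conic (sq_nonneg _) hc (hnorm hu₁) (hnorm hv₁) h.2.2.1 ?_
  rw [hinv hu₁, hinv hv₁, inner_mul_primRoot hu₁]

theorem exists_isPolygonSide_mem_segment (hn : 2 ≤ n) (hc : ‖c‖ < 1)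
    (hp : p ∈ inscribedConic n c) :
    ∃ μ : ℂ, ‖μ‖ = 1 ∧ ∃ z w : ℂ, IsPolygonSide (kleinMap (-c) '' {u | u ^ n = μ}) z w ∧
      p ∈ segment ℝ z w := by
  have hc' := (norm_neg c).trans_lt hc
  have hq := norm_kleinMap_of_mem_inscribedConic hn hc hp
  obtain ⟨u, hu, hmid⟩ :=
    exists_midpoint_mul_primRoot_eq (hq.trans (abs_of_nonneg (cos_pi_div_nonneg hn)).symm)
  have hμ : ‖u ^ n‖ = 1 := by rw [norm_pow, hu, one_pow]
  refine ⟨u ^ n, hμ, _, _, (isPolygonSide_kleinMap_nthRoots_iff hn hc' hμ).mpr ⟨u, rfl, rfl, rfl⟩,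
    ?_⟩
  have hmem : kleinMap c p ∈ convexHull ℝ {u, u * primRoot n} :=
    convexHull_pair (𝕜 := ℝ) u _ ▸ hmid ▸ midpoint_mem_segment u _
  have himage := kleinMap_mem_convexHull_image hc' (by
    rintro v (rfl | rfl)
    · exact hu.le
    · rw [norm_mul, hu, norm_primRoot, one_mul]) hmem
  rwa [kleinMap_neg_kleinMap hc (norm_lt_one_of_mem_inscribedConic hn hc hp).le, Set.image_pair,
    convexHull_pair] at himage

theorem exists_circleFiber_eq_kleinMap_image {B : ℂ → ℂ} (hB : ∀ z, ‖z‖ = 1 → ‖B z‖ = 1)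
    (hn : n ≠ 0) (hc : ‖c‖ < 1) (hfiber : ∀ l, ‖l‖ = 1 → ∃ μ : ℂ, ‖μ‖ = 1 ∧
      circleFiber B l = kleinMap c '' {u | u ^ n = μ}) (hμ : ‖μ‖ = 1) :
    ∃ l, ‖l‖ = 1 ∧ circleFiber B l = kleinMap c '' {u | u ^ n = μ} := by
  obtain ⟨u, rfl⟩ := IsAlgClosed.exists_pow_nat_eq μ (pos_of_ne_zero hn)
  have hu : ‖u‖ = 1 := norm_eq_one_of_pow_eq hn hμ rfl
  have hz : ‖kleinMap c u‖ = 1 := kleinMap_of_norm_eq_one hc hu ▸ norm_diskMobius_eq_one hc hu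
  refine ⟨B (kleinMap c u), hB _ hz, ?_⟩
  obtain ⟨ν, hν, heq⟩ := hfiber _ (hB _ hz)
  obtain ⟨v, hv, hvu⟩ := heq.subset ⟨hz, rfl⟩
  rw [kleinMap_eq_kleinMap_iff hc (norm_eq_one_of_pow_eq hn hν hv).le hu.le] at hvu
  rw [heq, ← hvu, hv]

theorem isBlaschkeCurve_inscribedConic {B : ℂ → ℂ} (hB : ∀ z, ‖z‖ = 1 → ‖B z‖ = 1) (hn : 2 ≤ n)
    (hc : ‖c‖ < 1) (hfiber : ∀ l, ‖l‖ = 1 → ∃ μ : ℂ, ‖μ‖ = 1 ∧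
      circleFiber B l = kleinMap (-c) '' {u | u ^ n = μ}) :
    IsBlaschkeCurve B (inscribedConic n c) where
  convex_curve := exists_convex_frontier_eq_inscribedConic hn hc
  subset_disk _ hp := mem_ball_zero_iff.mpr (norm_lt_one_of_mem_inscribedConic hn hc hp)
  subset_polygon l hl := by
    obtain ⟨μ, hμ, hl⟩ := hfiber l hl
    exact hl ▸ inscribedConic_subset_convexHull hn hc hμ
  side_tangent l hl z w h := by
    obtain ⟨μ, hμ, hl⟩ := hfiber l hl
    exact exists_segmentTangentAt_inscribedConic hn hc hμ (hl ▸ h)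
  point_of_tangency p hp := by
    obtain ⟨μ, hμ, z, w, hside, hpzw⟩ := exists_isPolygonSide_mem_segment hn hc hp
    obtain ⟨l, hl, heq⟩ := exists_circleFiber_eq_kleinMap_image hB (by omega)
      ((norm_neg c).trans_lt hc) hfiber hμ
    obtain ⟨q, hq⟩ := exists_segmentTangentAt_inscribedConic hn hc hμ hside
    obtain rfl : p = q := hq.1.subset ⟨hp, hpzw⟩
    exact ⟨l, hl, z, w, heq ▸ hside, hq⟩

end BlaschkeCurve

theorem proposition4p8 (n : ℕ) (γ : ℂ) (hγ : ‖γ‖ = 1) (a : Fin n → ℂ) (ha : ∀ j, ‖a j‖ < 1)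
    (hcrit : ∃! w : ℂ, w ∈ criticalValues (blaschkeProduct γ a)) :
    ∃ C : Set ℂ, IsBlaschkeCurve (blaschkeProduct γ a) C ∧
      ((n = 2 ∧ ∃ p : ℂ, C = {p}) ∨ (3 ≤ n ∧ IsEllipse C)) := by
  obtain ⟨w, hw⟩ := Set.singleton_iff_unique_mem.mpr hcrit
  have hn : 2 ≤ n := two_le_of_criticalValues_nonempty hγ ha (hw ▸ Set.singleton_nonempty w)
  have hn₀ : n ≠ 0 := by omega
  obtain ⟨c, hc, hfiber⟩ := exists_circleFiber_blaschkeProduct_eq_image_nthRoots hγ ha hn₀ hw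
  refine ⟨inscribedConic n c, isBlaschkeCurve_inscribedConic
    (fun _ => norm_blaschkeProduct_eq_one hγ ha) hn hc fun l hl => ?_, ?_⟩
  · obtain ⟨μ, hμ, heq⟩ := hfiber l hl
    exact ⟨μ, hμ, heq.trans (image_diskMobius_nthRoots hn₀ ((norm_neg c).trans_lt hc) hμ)⟩
  · rcases hn.eq_or_lt with rfl | hn₃
    · exact .inl ⟨rfl, _, inscribedConic_two hc⟩
    · exact .inr ⟨hn₃, isEllipse_inscribedConic hn₃ hc⟩
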